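/- Let $\lambda\in(0,\infty)$ and $a\in(0,1]$, and let $G_n$ be the Erdős–Rényi random graph $G(n,p_n)$ on the vertex set $[n]$ with $p_n=\lambda/n$ (for $n\ge\lambda$; the finitely many other $n$ play no role). Let $V_T(G)$ be the number of vertices of $G$ that are part of a triangle in $G$, and $e(G)$ the number of edges of $G$. Let $k_n\in\mathbb{N}_0$ be $an$ rounded to an integer, i.e. $|k_n-an|<1$ for all $n$ (so $k_n=an$ whenever $an$ is an integer; the rounding is otherwise arbitrary). Then the event $\{V_T(G_n)=k_n\}$ has positive probability for all large $n$, and, conditionally on this event, $e(G_n)/n$ satisfies the large deviation principle on $\mathbb{R}$ with speed $n$ and with good rate function $$I_\lambda(x)=\begin{cases}(x-a)\log\Big(\dfrac{x-a}{\lambda/2}\Big)-(x-a)+\dfrac{\lambda}{2}, & x\ge a,\\[1ex] \infty, & x<a,\end{cases}\qquad 0\log 0:=0.$$ That is, $I_\lambda\colon\mathbb{R}\to[0,\infty]$ is lower semicontinuous, the sets $\{x\in\mathbb{R}\colon I_\lambda(x)\le c\}$, $c\in\mathbb{R}$, are compact, and $$\limsup_{n\to\infty}\frac1n\log\mathbb{P}\Big(\tfrac{e(G_n)}{n}\in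 F\,\Big|\,V_T(G_n)=k_n\Big)\le-\inf_{x\in F}I_\lambda(x)\quad\text{for every closed }F\subseteq\mathbb{R},$$ $$\liminf_{n\to\infty}\frac1n\log\mathbb{P}\Big(\tfrac{e(G_n)}{n}\in U\,\Big|\,V_T(G_n)=k_n\Big)\ge-\inf_{x\in U}I_\lambda(x)\quad\text{for every open }U\subseteq\mathbb{R}.$$ -/

import Mathlib

open MeasureTheory ProbabilityTheory Filter Topology

noncomputable section

/-- The number `V_T(G)` of vertices of `G` that are part of a triangle of `G`. -/
def triangleVertexCount {V : Type*} (G : SimpleGraph V) : ℕ :=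
  {v : V | ∃ u w : V, G.Adj v u ∧ G.Adj v w ∧ G.Adj u w}.ncard

/-- The number `e(G)` of edges of `G`. -/
def edgeCount {V : Type*} (G : SimpleGraph V) : ℕ := G.edgeSet.ncard

/-- The edge probability `p_n = lam / n`, cut off to `[0, 1]`; for `lam > 0` the cut-off matters
only for `n < lam` (and `n = 0`). -/
def sparseEdgeProb (lam : ℝ) (n : ℕ) : unitInterval :=
  Set.projIcc (0 : ℝ) 1 zero_le_one (lam / n)

/-- The law of the random graph `G(n, lam / n)` on the vertex set `Fin n`: every edge is present
independently with probability `lam / n`. -/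
def sparseGraphLaw (lam : ℝ) (n : ℕ) : Measure (SimpleGraph (Fin n)) :=
  SimpleGraph.binomialRandom (Fin n) (sparseEdgeProb lam n)

/-- The random variables `Y n` under the probability measures `P n`, with values in a topological
space `X`, satisfy the large deviation principle with speed `v` and good rate function `I`.
A good rate function takes values in `[0, ∞]`, is lower semicontinuous and has compact sublevel
sets. -/
structure SatisfiesGoodLDP {Ω : ℕ → Type*} [∀ n, MeasurableSpace (Ω n)] {X : Type*}
    [TopologicalSpace X] (P : ∀ n, Measure (Ω n)) (Y : ∀ n, Ω n → X) (v : ℕ → ℝ)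
    (I : X → EReal) : Prop where
  speed_tendsto : Tendsto v atTop atTop
  eventually_prob : ∀ᶠ n in atTop, IsProbabilityMeasure (P n)
  rate_nonneg : ∀ x, 0 ≤ I x
  rate_lsc : LowerSemicontinuous I
  rate_good : ∀ c : ℝ, IsCompact {x | I x ≤ (c : EReal)}
  upper_bound : ∀ F : Set X, IsClosed F →
    limsup (fun n => (((v n)⁻¹ : ℝ) : EReal) * ENNReal.log (P n (Y n ⁻¹' F))) atTop
      ≤ -(⨅ x ∈ F, I x)
  lower_bound : ∀ U : Set X, IsOpen U →
    -(⨅ x ∈ U, I x)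
      ≤ liminf (fun n => (((v n)⁻¹ : ℝ) : EReal) * ENNReal.log (P n (Y n ⁻¹' U))) atTop

/-- The rate function `(x - a) log ((x - a) / (lam / 2)) - (x - a) + lam / 2` for `x ≥ a`
(with `0 log 0 = 0`), and `∞` for `x < a`. -/
def edgeRate (lam a x : ℝ) : EReal :=
  open Classical in
  if x < a then ⊤
  else (((x - a) * Real.log ((x - a) / (lam / 2)) - (x - a) + lam / 2 : ℝ) : EReal)

end

/-!
The proof has two parts. The combinatorial part determines how the probability of exactly `k n`
triangle vertices in `G(n, μ / n)` depends on `μ`: it is `μ ^ (a n)` times a quantity that does not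
depend on `μ`, up to a factor `e ^ o(n)` (`tendsto_log_triangleVertexCount`). The reason is that the
cheapest way to have `k` triangle vertices is to have `k / 3` disjoint triangles, which use `k`
edges.

* Lower bound: for a disjoint union `H` of triangles (one of which is replaced by a clique with four
  or five vertices if `3 ∤ k`), `H` occurs with probability about `(μ / n) ^ k`, and by Harris'
  inequality no further triangles occur with probability bounded away from zero
  (`le_binomialRandom_real_trianglesWithin`). The events for different `H` are disjoint, and the
  number of such `H` satisfies a simple recursion (`clusterCount_le_ncard`).
* Upper bound: a union bound over ways to cover the `k` vertices by triangles, one after the other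
  (`binomialRandom_real_cover_le`). The resulting recursion also counts overlapping triangles; its
  exponential generating function is `exp (w ^ 3 / 6 + O(w ^ 2))` in the variable `w = p z`, while
  disjoint triangles alone give `exp (w ^ 3 / 6)`. At the relevant `w`, of order `n ^ (1 / 3)`, the
  difference is `e ^ O(n ^ (2 / 3))` (`coverBound_mul_pow_le`, `factorial_div_pow_mul_exp_le`).

The analytic part is a tilting argument. Weighting `G(n, p)` with `e ^ (t e(G))` gives, up to an
explicit normalisation, `G(n, p')` with `p' ≈ p e ^ t` (`mgf_edgeCount_cond`). So the conditional
moment generating function of `e(G)` is the normalisation times the quotient of the probabilities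
of `k n` triangle vertices for `p'` and `p`, and its exponential growth rate is
`(lam / 2) (e ^ t - 1) + a t` (`tendsto_log_mgf_edgeCount`). This limit is finite and differentiable
everywhere, and `edgeRate` is its Legendre transform, so that the large deviation principle follows
as in the Gärtner–Ellis theorem (`satisfiesGoodLDP_of_tendsto_mgf`).
-/

/-! ### The binomial random graph on finitely many vertices -/

namespace SimpleGraph

section Basics

variable {V : Type*}

/-- The probability `p ^ e(G) * (1 - p) ^ (N - e(G))` of the single graph `G` under `G(V, p)`, where
`N` is the number of pairs of vertices. -/
noncomputable def graphWeight (p : ℝ) (G : SimpleGraph V) : ℝ :=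
  p ^ edgeCount G * (1 - p) ^ ((Nat.card V).choose 2 - edgeCount G)

theorem graphWeight_nonneg {p : ℝ} (h0 : 0 ≤ p) (h1 : p ≤ 1) (G : SimpleGraph V) :
    0 ≤ graphWeight p G :=
  mul_nonneg (pow_nonneg h0 _) (pow_nonneg (by linarith) _)

variable [Finite V]

instance : MeasurableSingletonClass (SimpleGraph V) where
  measurableSet_singleton G := by
    have h : MeasurableSet ({G.edgeSet} : Set (Set (Sym2 V))) := by
      have := (MeasurableEquiv.setOfPred (α := Sym2 V)).symm.measurable
        (measurableSet_singleton (MeasurableEquiv.setOfPred.symm G.edgeSet))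
      convert this using 1
      ext s
      simp
    have h2 := (measurableEmbedding_edgeSet (V := V)).measurable h
    convert h2 using 1
    ext G'
    simp

theorem edgeCount_le_choose (G : SimpleGraph V) : edgeCount G ≤ (Nat.card V).choose 2 := by
  classical
  cases nonempty_fintype V
  rw [edgeCount, Nat.card_eq_fintype_card, Set.ncard_eq_toFinset_card']
  exact G.card_edgeFinset_le_card_choose_two

theorem binomialRandom_real_singleton (p : unitInterval) (G : SimpleGraph V) :
    (binomialRandom V p).real {G} = graphWeight p G := by
  simp [measureReal_def, graphWeight, edgeCount]

open Classical in
theorem binomialRandom_real_eq_sum [Fintype (SimpleGraph V)] (p : unitInterval)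
    (A : Set (SimpleGraph V)) :
    (binomialRandom V p).real A = ∑ G, if G ∈ A then graphWeight (p : ℝ) G else 0 := by
  rw [← Finset.sum_filter]
  simp_rw [← binomialRandom_real_singleton]
  rw [sum_measureReal_singleton]
  congr 1
  ext; simp

theorem edgeCount_sup_add_edgeCount_inf (G H : SimpleGraph V) :
    edgeCount (G ⊔ H) + edgeCount (G ⊓ H) = edgeCount G + edgeCount H := by
  simp only [edgeCount, edgeSet_sup, edgeSet_inf]
  exact Set.ncard_union_add_ncard_inter _ _ (Set.toFinite _) (Set.toFinite _)

theorem graphWeight_mul_graphWeight (p : ℝ) (G H : SimpleGraph V) :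
    graphWeight p G * graphWeight p H = graphWeight p (G ⊓ H) * graphWeight p (G ⊔ H) := by
  have h := edgeCount_sup_add_edgeCount_inf G H
  have h1 := edgeCount_le_choose G
  have h2 := edgeCount_le_choose H
  have h3 := edgeCount_le_choose (G ⊔ H)
  have h4 := edgeCount_le_choose (G ⊓ H)
  unfold graphWeight
  rw [mul_mul_mul_comm, mul_mul_mul_comm (p ^ edgeCount (G ⊓ H)), ← pow_add, ← pow_add, ← pow_add, ← pow_add]
  congr 2 <;> omega

/-- `G(V, p)` contains a given graph `H` with probability `p ^ e(H)`. -/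
theorem binomialRandom_real_Ici (p : unitInterval) (H : SimpleGraph V) :
    (binomialRandom V p).real {G | H ≤ G} = (p : ℝ) ^ edgeCount H := by
  classical
  cases nonempty_fintype V
  rw [binomialRandom_real_eq_sum, ← Finset.sum_filter]
  set D : Finset (Sym2 V) := (⊤ : SimpleGraph V).edgeFinset \ H.edgeFinset with hD
  have hN : (Nat.card V).choose 2 = edgeCount H + D.card := by
    rw [hD, Finset.card_sdiff_of_subset (edgeFinset_mono le_top), edgeCount, Set.ncard_eq_toFinset_card',
      card_edgeFinset_top_eq_card_choose_two, Nat.card_eq_fintype_card]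
    have := H.card_edgeFinset_le_card_choose_two
    simp only [edgeFinset] at *
    omega
  have key := Finset.sum_pow_mul_eq_add_pow (p : ℝ) (1 - p) D
  rw [show (p : ℝ) + (1 - p) = 1 by ring, one_pow] at key
  rw [← mul_one ((p : ℝ) ^ edgeCount H), ← key, Finset.mul_sum]
  refine Finset.sum_bij' (fun G _ => G.edgeFinset \ H.edgeFinset)
    (fun t _ => H ⊔ fromEdgeSet (t : Set (Sym2 V))) ?_ ?_ ?_ ?_ ?_
  · intro G hG
    simp only [Finset.mem_powerset, hD]
    exact Finset.sdiff_subset_sdiff (edgeFinset_mono le_top) le_rfl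
  · intro t ht
    simp
  · intro G hG
    simp only [Finset.mem_filter, Finset.mem_univ, true_and, Set.mem_ofPred_eq] at hG
    simp [hG]
  · intro t ht
    simp only [Finset.mem_powerset, hD] at ht
    ext e
    have := @ht e
    simp only [Finset.mem_sdiff, mem_edgeFinset, edgeSet_sup, edgeSet_fromEdgeSet, Set.mem_union,
      Set.mem_sdiff, Finset.mem_coe, edgeSet_top] at this ⊢
    simp only [Set.mem_compl_iff] at this
    tauto
  · intro G hG
    simp only [Finset.mem_filter, Finset.mem_univ, true_and, Set.mem_ofPred_eq] at hG
    have h1 : edgeCount G = edgeCount H + (G.edgeFinset \ H.edgeFinset).card := by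
      rw [Finset.card_sdiff_of_subset (by simpa using hG)]
      have := Finset.card_le_card (edgeFinset_mono hG)
      simp only [edgeCount, Set.ncard_eq_toFinset_card', edgeFinset] at *
      omega
    rw [graphWeight, h1, hN, pow_add, mul_assoc, Nat.add_sub_add_left]

/-- Harris' inequality for decreasing events, under `G(V, p)` restricted to the graphs
containing `H`. -/
theorem harris_lower (p : unitInterval) (H : SimpleGraph V) {A B : Set (SimpleGraph V)}
    (hA : IsLowerSet A) (hB : IsLowerSet B) :
    (binomialRandom V p).real ({G | H ≤ G} ∩ A) * (binomialRandom V p).real ({G | H ≤ G} ∩ B) ≤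
      (p : ℝ) ^ edgeCount H * (binomialRandom V p).real ({G | H ≤ G} ∩ (A ∩ B)) := by
  classical
  cases nonempty_fintype V
  rw [← binomialRandom_real_Ici]
  simp_rw [binomialRandom_real_eq_sum]
  have hw : ∀ K : SimpleGraph V, 0 ≤ if H ≤ K then graphWeight (p : ℝ) K else 0 := fun K => by
    split_ifs
    exacts [graphWeight_nonneg p.2.1 p.2.2 _, le_rfl]
  have : (∑ G : SimpleGraph V, (if H ≤ G then graphWeight (p : ℝ) G else 0) *
        (if G ∈ A then 1 else 0)) * (∑ G : SimpleGraph V,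
        (if H ≤ G then graphWeight (p : ℝ) G else 0) * (if G ∈ B then 1 else 0)) ≤
      (∑ G : SimpleGraph V, if H ≤ G then graphWeight (p : ℝ) G else 0) *
        (∑ G : SimpleGraph V, (if H ≤ G then graphWeight (p : ℝ) G else 0) *
          ((if G ∈ A then 1 else 0) * (if G ∈ B then 1 else 0))) := fkg (α := (SimpleGraph V)ᵒᵈ) (β := ℝ)
    (fun G => if OrderDual.ofDual G ∈ A then 1 else 0)
    (fun G => if OrderDual.ofDual G ∈ B then 1 else 0)
    (fun G => if H ≤ OrderDual.ofDual G then graphWeight p (OrderDual.ofDual G) else 0)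
    (fun G => hw _)
    (fun G => by dsimp only [Pi.zero_apply]; split_ifs <;> norm_num)
    (fun G => by dsimp only [Pi.zero_apply]; split_ifs <;> norm_num)
    (fun G G' h => by
      dsimp only; split_ifs with h1 h2
      exacts [le_rfl, absurd (hA h h1) h2, by norm_num, le_rfl])
    (fun G G' h => by
      dsimp only; split_ifs with h1 h2
      exacts [le_rfl, absurd (hB h h1) h2, by norm_num, le_rfl])
    (fun G G' => by
      have e := graphWeight_mul_graphWeight (p : ℝ) (OrderDual.ofDual G) (OrderDual.ofDual G')
      simp only [ofDual_inf, ofDual_sup]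
      by_cases h1 : H ≤ OrderDual.ofDual G <;> by_cases h2 : H ≤ OrderDual.ofDual G'
      · simp [h1, h2, le_sup_of_le_left, e, mul_comm]
      all_goals
        simp only [h1, h2, if_true, if_false, mul_zero, zero_mul]
        exact mul_nonneg (hw _) (hw _))
  refine le_of_eq_of_le (congrArg₂ _ ?_ ?_) (this.trans_eq (congrArg _ ?_))
  all_goals
    refine Finset.sum_congr rfl fun G _ => ?_
    simp only [Set.mem_inter_iff, Set.mem_ofPred_eq]
    by_cases h1 : H ≤ G <;> by_cases h2 : G ∈ A <;> by_cases h3 : G ∈ B <;>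
      simp [h1, h2, h3]

/-- By Harris' inequality, the probability that `G(V, p)` contains `H` but none of the graphs `B i`
is at least the value it would have if these were independent given `H`. -/
theorem pow_mul_prod_le_binomialRandom_real (p : unitInterval) (hp : 0 < (p : ℝ))
    (H : SimpleGraph V) {ι : Type*} (s : Finset ι) (B : ι → SimpleGraph V) (d : ι → ℕ)
    (hd : ∀ i ∈ s, edgeCount H + d i ≤ edgeCount (H ⊔ B i)) :
    (p : ℝ) ^ edgeCount H * ∏ i ∈ s, (1 - (p : ℝ) ^ d i) ≤
      (binomialRandom V p).real {G | H ≤ G ∧ ∀ i ∈ s, ¬ B i ≤ G} := by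
  classical
  induction s using Finset.induction_on with
  | empty => simp [binomialRandom_real_Ici]
  | insert i s hi ih =>
    have ih := ih fun j hj => hd j (Finset.mem_insert_of_mem hj)
    have hpow : 0 < (p : ℝ) ^ edgeCount H := pow_pos hp _
    have h1 : (p : ℝ) ^ edgeCount H * (1 - (p : ℝ) ^ d i) ≤
        (binomialRandom V p).real ({G | H ≤ G} ∩ {G | ¬ B i ≤ G}) := by
      have e : ({G | H ≤ G} ∩ {G | ¬ B i ≤ G} : Set (SimpleGraph V)) =
          {G | H ≤ G} \ {G | H ⊔ B i ≤ G} := by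
        ext G; simp; tauto
      have hsub : ({G | H ⊔ B i ≤ G} : Set (SimpleGraph V)) ⊆ {G | H ≤ G} := by
        intro G hG
        simp only [Set.mem_ofPred_eq] at hG ⊢
        exact le_sup_left.trans hG
      rw [e, measureReal_sdiff hsub (Set.toFinite _).measurableSet, binomialRandom_real_Ici, binomialRandom_real_Ici]
      have := pow_le_pow_of_le_one p.2.1 p.2.2 (hd i (Finset.mem_insert_self _ _))
      rw [pow_add] at this
      linarith
    have hh := harris_lower p H (A := {G | ¬ B i ≤ G}) (B := {G | ∀ j ∈ s, ¬ B j ≤ G})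
      (fun G G' h hG hG' => hG (hG'.trans h)) (fun G G' h hG j hj hG' => hG j hj (hG'.trans h))
    have e1 : ({G | H ≤ G} ∩ {G | ∀ j ∈ s, ¬ B j ≤ G} : Set (SimpleGraph V)) =
        {G | H ≤ G ∧ ∀ j ∈ s, ¬ B j ≤ G} := rfl
    have e2 : ({G | H ≤ G} ∩ ({G | ¬ B i ≤ G} ∩ {G | ∀ j ∈ s, ¬ B j ≤ G}) : Set (SimpleGraph V)) =
        {G | H ≤ G ∧ ∀ j ∈ insert i s, ¬ B j ≤ G} := by
      ext G; simp
    rw [e1, e2] at hh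
    rw [Finset.prod_insert hi, ← mul_le_mul_iff_right₀ hpow]
    refine le_trans ?_ hh
    refine le_trans (le_of_eq ?_) (mul_le_mul h1 ih ?_ measureReal_nonneg)
    · ring
    · exact mul_nonneg hpow.le (Finset.prod_nonneg fun j _ => by
        have := pow_le_one₀ (n := d j) p.2.1 p.2.2
        linarith)

end Basics

end SimpleGraph

/-! ### Covering vertices by triangles -/

namespace SimpleGraph

section Triangles

variable {V : Type*}

/-- The vertex `v` is part of a triangle of `G`. -/
def InTriangle (G : SimpleGraph V) (v : V) : Prop :=
  ∃ u w : V, G.Adj v u ∧ G.Adj v w ∧ G.Adj u w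

theorem InTriangle.mono {G H : SimpleGraph V} (h : G ≤ H) {v : V} (hv : G.InTriangle v) :
    H.InTriangle v := by
  obtain ⟨u, w, h1, h2, h3⟩ := hv
  exact ⟨u, w, h h1, h h2, h h3⟩

/-- The graph with the three edges `ab`, `ac` and `bc`. -/
def triangleGraph (a b c : V) : SimpleGraph V := fromEdgeSet {s(a, b), s(a, c), s(b, c)}

theorem triangleGraph_le_iff {a b c : V} (hab : a ≠ b) (hac : a ≠ c) (hbc : b ≠ c)
    {G : SimpleGraph V} : triangleGraph a b c ≤ G ↔ G.Adj a b ∧ G.Adj a c ∧ G.Adj b c := by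
  rw [triangleGraph, ← edgeSet_subset_edgeSet, edgeSet_fromEdgeSet]
  constructor
  · intro h
    refine ⟨h (a := s(a, b)) ?_, h (a := s(a, c)) ?_, h (a := s(b, c)) ?_⟩ <;> simp [*]
  · rintro ⟨h1, h2, h3⟩ e ⟨he, -⟩
    simp only [Set.mem_insert_iff, Set.mem_singleton_iff] at he
    rcases he with rfl | rfl | rfl <;> simpa

theorem edgeSet_sup_triangleGraph {a b c : V} (hab : a ≠ b) (hac : a ≠ c) (hbc : b ≠ c)
    (H : SimpleGraph V) : (H ⊔ triangleGraph a b c).edgeSet =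
      insert s(a, b) (insert s(a, c) (insert s(b, c) H.edgeSet)) := by
  rw [edgeSet_sup, triangleGraph, edgeSet_fromEdgeSet]
  ext e
  simp only [Set.mem_union, Set.mem_sdiff, Set.mem_insert_iff, Set.mem_singleton_iff,
    Sym2.mem_diagSet]
  constructor
  · tauto
  · rintro (rfl | rfl | rfl | h)
    · simp [hab]
    · simp [hac]
    · simp [hbc]
    · exact Or.inl h

variable [Finite V]

theorem edgeCount_sup_triangleGraph_of_not_adj {a b c : V} (hab : a ≠ b) (hac : a ≠ c)
    (hbc : b ≠ c) {H : SimpleGraph V} (h1 : ¬ H.Adj a b) (h2 : ¬ H.Adj a c) (h3 : ¬ H.Adj b c) :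
    edgeCount (H ⊔ triangleGraph a b c) = edgeCount H + 3 := by
  rw [edgeCount, edgeSet_sup_triangleGraph hab hac hbc, Set.ncard_insert_of_notMem,
    Set.ncard_insert_of_notMem, Set.ncard_insert_of_notMem, edgeCount] <;>
  simp [*, hab.symm, hbc.symm]

theorem edgeCount_sup_triangleGraph_of_adj {a b c : V} (hab : a ≠ b) (hac : a ≠ c)
    {H : SimpleGraph V} (h1 : ¬ H.Adj a b) (h2 : ¬ H.Adj a c) (h3 : H.Adj b c) :
    edgeCount (H ⊔ triangleGraph a b c) = edgeCount H + 2 := by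
  have hbc := h3.ne
  rw [edgeCount, edgeSet_sup_triangleGraph hab hac hbc, Set.insert_eq_of_mem (a := s(b, c)),
    Set.ncard_insert_of_notMem, Set.ncard_insert_of_notMem, edgeCount] <;>
  simp [*, hab.symm]

end Triangles

section Cover

variable {V : Type*} [Fintype V]

theorem card_filter_adj [DecidableEq V] (H : SimpleGraph V) [DecidableRel H.Adj] :
    (Finset.univ.filter fun x : V × V => H.Adj x.1 x.2).card = 2 * edgeCount H := by
  have h := H.sum_degrees_eq_twice_card_edges
  rw [edgeCount, Set.ncard_eq_toFinset_card']
  have e : H.edgeSet.toFinset = H.edgeFinset := rfl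
  rw [e, ← h, Finset.card_filter, ← Finset.univ_product_univ, Finset.sum_product]
  refine Finset.sum_congr rfl fun x _ => ?_
  rw [← Finset.card_filter, ← card_neighborFinset_eq_degree, neighborFinset_eq_filter]

/-- The solution of the recursion that results from covering `u` vertices by triangles one after
the other: the next triangle meets the uncovered vertices in three, two or one of them, with
weights `α`, `β` and `γ`. Its exponential generating function is
`exp (α z ^ 3 / 6 + β z ^ 2 / 2 + γ z)`. -/
noncomputable def coverBound (α β γ : ℝ) : ℕ → ℝ
  | 0 => 1
  | u + 1 => α * u.choose 2 * coverBound α β γ (u - 2) + β * u * coverBound α β γ (u - 1) +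
      γ * coverBound α β γ u

theorem coverBound_nonneg {α β γ : ℝ} (hα : 0 ≤ α) (hβ : 0 ≤ β) (hγ : 0 ≤ γ) (u : ℕ) :
    0 ≤ coverBound α β γ u := by
  induction u using Nat.strong_induction_on with
  | _ u ih =>
    cases u with
    | zero => simp [coverBound]
    | succ u =>
      rw [coverBound]
      have h1 := ih (u - 2) (by omega)
      have h2 := ih (u - 1) (by omega)
      have h3 := ih u (by omega)
      positivity

/-- The probability that `G(V, p)` contains `H` and has all vertices of `U` in triangles is at most
`p ^ e(H)` times `coverBound`, if `H` does not touch `U`. The proof is a union bound over the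
triangle that contains a given vertex of `U`; this triangle is added to `H`, and its vertices are
removed from `U`. -/
theorem binomialRandom_real_cover_le (p : unitInterval) (u : ℕ) :
    ∀ (U : Finset V) (H : SimpleGraph V), U.card = u → (∀ x ∈ U, ∀ y, ¬ H.Adj x y) →
      edgeCount H + 3 * u ≤ 3 * Fintype.card V →
      (binomialRandom V p).real {G | H ≤ G ∧ ∀ x ∈ U, G.InTriangle x} ≤
        (p : ℝ) ^ edgeCount H * coverBound ((p : ℝ) ^ 3) (Fintype.card V * (p : ℝ) ^ 3)
          ((Fintype.card V : ℝ) ^ 2 * (p : ℝ) ^ 3 + 6 * Fintype.card V * (p : ℝ) ^ 2) u := by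
  classical
  set n := Fintype.card V with hn
  set α := (p : ℝ) ^ 3 with hα
  set β := n * (p : ℝ) ^ 3 with hβ
  set γ := (n : ℝ) ^ 2 * (p : ℝ) ^ 3 + 6 * n * (p : ℝ) ^ 2 with hγ
  have hp0 : 0 ≤ (p : ℝ) := p.2.1
  have hF : ∀ m, 0 ≤ coverBound α β γ m :=
    coverBound_nonneg (by positivity) (by positivity) (by positivity)
  induction u using Nat.strong_induction_on with
  | _ u ih =>
    intro U H hU hH he
    cases u with
    | zero =>
      rw [coverBound, mul_one, ← binomialRandom_real_Ici]
      refine measureReal_mono ?_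
      intro G hG
      simp only [Set.mem_ofPred_eq] at hG ⊢
      exact hG.1
    | succ u =>
      obtain ⟨v, hv⟩ : U.Nonempty := by rw [← Finset.card_pos]; omega
      have hUv : (U.erase v).card = u := by rw [Finset.card_erase_of_mem hv]; omega
      set P := binomialRandom V p
      set Q : V → V → V → Set (SimpleGraph V) := fun a b c =>
        {G | (H ≤ G ∧ ∀ x ∈ U, G.InTriangle x) ∧ G.Adj a b ∧ G.Adj a c ∧ G.Adj b c} with hQ
      -- the induction hypothesis, applied after the triangle `abc` has been added to `H`
      have step : ∀ (a b c : V) (d m : ℕ) (U' : Finset V), a ≠ b → a ≠ c → b ≠ c → U' ⊆ U →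
          a ∉ U' → b ∉ U' → c ∉ U' → U'.card = m → m ≤ u → d ≤ 3 →
          edgeCount (H ⊔ triangleGraph a b c) = edgeCount H + d →
          P.real (Q a b c) ≤ (p : ℝ) ^ edgeCount H * ((p : ℝ) ^ d * coverBound α β γ m) := by
        intro a b c d m U' hab hac hbc hU' ha hb hc hm hmu hd hed
        have := ih m (by omega) U' (H ⊔ triangleGraph a b c) hm ?_ (by omega)
        · rw [hed, pow_add, mul_assoc] at this
          refine le_trans (measureReal_mono ?_) this
          intro G hG
          simp only [hQ, Set.mem_ofPred_eq] at hG ⊢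
          exact ⟨sup_le hG.1.1 ((triangleGraph_le_iff hab hac hbc).2 hG.2),
            fun x hx => hG.1.2 x (hU' hx)⟩
        · intro x hx y hxy
          have hxy' : s(x, y) ∈ (H ⊔ triangleGraph a b c).edgeSet := hxy
          rw [edgeSet_sup_triangleGraph hab hac hbc] at hxy'
          simp only [Set.mem_insert_iff, mem_edgeSet, Sym2.eq_iff] at hxy'
          have h1 := hH x (hU' hx) y
          have hxa : x ≠ a := fun h => ha (h ▸ hx)
          have hxb : x ≠ b := fun h => hb (h ▸ hx)
          have hxc : x ≠ c := fun h => hc (h ▸ hx)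
          tauto
      have hH' : ∀ x ∈ U, ∀ y, ¬ H.Adj y x := fun x hx y h => hH x hx y h.symm
      set X : ℝ := (p : ℝ) ^ edgeCount H with hX
      have hX0 : 0 ≤ X := by positivity
      set S1 := Finset.powersetCard 2 (U.erase v)
      set S2 := (U.erase v) ×ˢ (Finset.univ.filter fun c => c ∉ U)
      set S3 := Finset.univ.filter fun x : V × V => x.1 ∉ U ∧ x.2 ∉ U ∧ x.1 ≠ x.2 ∧ ¬ H.Adj x.1 x.2
      set S4 := Finset.univ.filter fun x : V × V => H.Adj x.1 x.2 ∧ x.1 ∉ U ∧ x.2 ∉ U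
      set E1 : Set (SimpleGraph V) := ⋃ s ∈ S1, {G | (H ≤ G ∧ ∀ x ∈ U, G.InTriangle x) ∧
        G.IsClique (insert v (s : Set V))}
      set E2 : Set (SimpleGraph V) := ⋃ x ∈ S2, Q v x.1 x.2
      set E3 : Set (SimpleGraph V) := ⋃ x ∈ S3, Q v x.1 x.2
      set E4 : Set (SimpleGraph V) := ⋃ x ∈ S4, Q v x.1 x.2
      have hcover : {G | H ≤ G ∧ ∀ x ∈ U, G.InTriangle x} ⊆ ((E1 ∪ E2) ∪ E3) ∪ E4 := by
        intro G hG
        simp only [Set.mem_ofPred_eq] at hG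
        obtain ⟨b, c, hb, hc, hbc⟩ := hG.2 v hv
        by_cases hbU : b ∈ U <;> by_cases hcU : c ∈ U
        · refine Or.inl (Or.inl (Or.inl ?_))
          refine Set.mem_biUnion (x := {b, c}) ?_ ?_
          · simp only [S1, Finset.mem_coe, Finset.mem_powersetCard]
            refine ⟨?_, Finset.card_pair hbc.ne⟩
            intro x hx
            simp only [Finset.mem_insert, Finset.mem_singleton] at hx
            rcases hx with rfl | rfl
            · simp [hbU, hb.ne']
            · simp [hcU, hc.ne']
          · simp only [Set.mem_ofPred_eq]
            refine ⟨hG, ?_⟩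
            simp only [Finset.coe_insert, Finset.coe_singleton]
            simp [isClique_insert, hb, hc, hbc]
        · refine Or.inl (Or.inl (Or.inr ?_))
          refine Set.mem_biUnion (x := (b, c)) ?_ ?_
          · simp [S2, hbU, hcU, hb.ne']
          · simp only [hQ, Set.mem_ofPred_eq]
            exact ⟨hG, hb, hc, hbc⟩
        · refine Or.inl (Or.inl (Or.inr ?_))
          refine Set.mem_biUnion (x := (c, b)) ?_ ?_
          · simp [S2, hbU, hcU, hc.ne']
          · simp only [hQ, Set.mem_ofPred_eq]
            exact ⟨hG, hc, hb, hbc.symm⟩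
        · by_cases hadj : H.Adj b c
          · refine Or.inr (Set.mem_biUnion (x := (b, c)) ?_ ?_)
            · simp [S4, hadj, hbU, hcU]
            · simp only [hQ, Set.mem_ofPred_eq]
              exact ⟨hG, hb, hc, hbc⟩
          · refine Or.inl (Or.inr (Set.mem_biUnion (x := (b, c)) ?_ ?_))
            · simp [S3, hadj, hbU, hcU, hbc.ne]
            · simp only [hQ, Set.mem_ofPred_eq]
              exact ⟨hG, hb, hc, hbc⟩
      have b1 : P.real E1 ≤ u.choose 2 * (X * ((p : ℝ) ^ 3 * coverBound α β γ (u - 2))) := by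
        refine (measureReal_biUnion_finset_le _ _).trans ?_
        refine (Finset.sum_le_card_nsmul _ _
          (X * ((p : ℝ) ^ 3 * coverBound α β γ (u - 2))) ?_).trans_eq ?_
        · intro s hs
          rw [Finset.mem_powersetCard] at hs
          obtain ⟨hs, hs2⟩ := hs
          obtain ⟨b, c, hbc, rfl⟩ := Finset.card_eq_two.1 hs2
          have hb := Finset.mem_erase.1 (hs (by simp : b ∈ ({b, c} : Finset V)))
          have hc := Finset.mem_erase.1 (hs (by simp : c ∈ ({b, c} : Finset V)))
          refine le_trans (measureReal_mono ?_) (step v b c 3 (u - 2) ((U.erase v) \ {b, c})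
            hb.1.symm hc.1.symm hbc
            (Finset.sdiff_subset.trans (Finset.erase_subset _ _)) (by simp) (by simp) (by simp)
            ?_ (by omega) le_rfl (edgeCount_sup_triangleGraph_of_not_adj hb.1.symm hc.1.symm hbc
              (hH v hv _) (hH v hv _) (hH b hb.2 _)))
          · intro G hG
            simp only [hQ, Set.mem_ofPred_eq] at hG ⊢
            refine ⟨hG.1, hG.2 ?_ ?_ hb.1.symm, hG.2 ?_ ?_ hc.1.symm, hG.2 ?_ ?_ hbc⟩ <;> simp
          · rw [Finset.card_sdiff_of_subset hs, hs2, hUv]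
        · rw [Finset.card_powersetCard, hUv, nsmul_eq_mul]
      have b2 : P.real E2 ≤ (u * n) * (X * ((p : ℝ) ^ 3 * coverBound α β γ (u - 1))) := by
        refine (measureReal_biUnion_finset_le _ _).trans ?_
        refine (Finset.sum_le_card_nsmul _ _
          (X * ((p : ℝ) ^ 3 * coverBound α β γ (u - 1))) ?_).trans ?_
        · rintro ⟨b, c⟩ hs
          simp only [S2, Finset.mem_product, Finset.mem_erase, Finset.mem_filter, Finset.mem_univ,
            true_and] at hs
          obtain ⟨hb, hc⟩ := hs
          have hvc : v ≠ c := fun h => hc (h ▸ hv)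
          have hbc : b ≠ c := fun h => hc (h ▸ hb.2)
          refine step v b c 3 (u - 1) ((U.erase v).erase b) hb.1.symm hvc hbc
            ((Finset.erase_subset _ _).trans (Finset.erase_subset _ _)) (by simp) (by simp)
            (by simp [hc]) ?_ (by omega) le_rfl (edgeCount_sup_triangleGraph_of_not_adj hb.1.symm
              hvc hbc (hH v hv _) (hH v hv _) (hH b hb.2 _))
          rw [Finset.card_erase_of_mem (by simp [hb]), hUv]
        · rw [Finset.card_product, hUv, nsmul_eq_mul]
          refine mul_le_mul_of_nonneg_right ?_ (mul_nonneg hX0 (mul_nonneg (by positivity) (hF _)))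
          push_cast
          gcongr
          exact Finset.card_le_univ _
      have b3 : P.real E3 ≤ (n ^ 2 : ℝ) * (X * ((p : ℝ) ^ 3 * coverBound α β γ u)) := by
        refine (measureReal_biUnion_finset_le _ _).trans ?_
        refine (Finset.sum_le_card_nsmul _ _
          (X * ((p : ℝ) ^ 3 * coverBound α β γ u)) ?_).trans ?_
        · rintro ⟨b, c⟩ hs
          simp only [S3, Finset.mem_filter, Finset.mem_univ, true_and] at hs
          obtain ⟨hb, hc, hbc, hadj⟩ := hs
          have hvc : v ≠ c := fun h => hc (h ▸ hv)
          have hvb : v ≠ b := fun h => hb (h ▸ hv)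
          exact step v b c 3 u (U.erase v) hvb hvc hbc (Finset.erase_subset _ _) (by simp)
            (by simp [hb]) (by simp [hc]) hUv le_rfl le_rfl
            (edgeCount_sup_triangleGraph_of_not_adj hvb hvc hbc (hH v hv _) (hH v hv _) hadj)
        · rw [nsmul_eq_mul]
          refine mul_le_mul_of_nonneg_right ?_ (mul_nonneg hX0 (mul_nonneg (by positivity) (hF _)))
          have : S3.card ≤ n ^ 2 := by
            refine (Finset.card_le_univ _).trans ?_
            rw [Fintype.card_prod, sq]
          exact_mod_cast this
      have b4 : P.real E4 ≤ (6 * n : ℝ) * (X * ((p : ℝ) ^ 2 * coverBound α β γ u)) := by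
        refine (measureReal_biUnion_finset_le _ _).trans ?_
        refine (Finset.sum_le_card_nsmul _ _
          (X * ((p : ℝ) ^ 2 * coverBound α β γ u)) ?_).trans ?_
        · rintro ⟨b, c⟩ hs
          simp only [S4, Finset.mem_filter, Finset.mem_univ, true_and] at hs
          obtain ⟨hadj, hb, hc⟩ := hs
          have hvc : v ≠ c := fun h => hc (h ▸ hv)
          have hvb : v ≠ b := fun h => hb (h ▸ hv)
          exact step v b c 2 u (U.erase v) hvb hvc hadj.ne (Finset.erase_subset _ _) (by simp)
            (by simp [hb]) (by simp [hc]) hUv le_rfl (by norm_num)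
            (edgeCount_sup_triangleGraph_of_adj hvb hvc (hH v hv _) (hH v hv _) hadj)
        · rw [nsmul_eq_mul]
          refine mul_le_mul_of_nonneg_right ?_ (mul_nonneg hX0 (mul_nonneg (by positivity) (hF _)))
          have h1 : S4.card ≤ 2 * edgeCount H := by
            rw [← card_filter_adj]
            refine Finset.card_le_card ?_
            intro x hx
            simp only [S4, Finset.mem_filter] at hx ⊢
            exact ⟨hx.1, hx.2.1⟩
          have : S4.card ≤ 6 * n := by omega
          exact_mod_cast this
      have hall : P.real {G | H ≤ G ∧ ∀ x ∈ U, G.InTriangle x} ≤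
          ((P.real E1 + P.real E2) + P.real E3) + P.real E4 := by
        refine (measureReal_mono hcover).trans ((measureReal_union_le _ _).trans ?_)
        gcongr
        refine (measureReal_union_le _ _).trans ?_
        gcongr
        exact measureReal_union_le _ _
      refine hall.trans ((add_le_add (add_le_add (add_le_add b1 b2) b3) b4).trans_eq ?_)
      rw [coverBound, hα, hβ, hγ]
      ring

end Cover

end SimpleGraph

/-! ### The generating function of the covering recursion -/

namespace SimpleGraph

theorem sum_range_shift_le {f : ℕ → ℝ} (hf : ∀ u, 0 ≤ f u) (j m : ℕ) :
    ∑ u ∈ Finset.range m, (if j ≤ u then f (u - j) else 0) ≤ ∑ u ∈ Finset.range m, f u := by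
  have h : ∑ u ∈ Finset.range m, (if j ≤ u then f (u - j) else 0) =
      ∑ u ∈ Finset.range (m - j), f u := by
    induction m with
    | zero => simp
    | succ m ih =>
      rw [Finset.sum_range_succ, ih]
      split_ifs with hj
      · rw [Nat.succ_sub hj, Finset.sum_range_succ]
      · rw [Nat.sub_eq_zero_of_le (by omega), Nat.sub_eq_zero_of_le (by omega)]
        simp
  rw [h]
  exact Finset.sum_le_sum_of_subset_of_nonneg (Finset.range_mono (Nat.sub_le _ _))
    fun u _ _ => hf u

theorem coverBound_succ_div_factorial (α β γ z : ℝ) (u : ℕ) :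
    coverBound α β γ (u + 1) / u.factorial * z ^ u =
      α * z ^ 2 / 2 * (if 2 ≤ u then coverBound α β γ (u - 2) / (u - 2).factorial * z ^ (u - 2)
        else 0) +
      β * z * (if 1 ≤ u then coverBound α β γ (u - 1) / (u - 1).factorial * z ^ (u - 1) else 0) +
      γ * (coverBound α β γ u / u.factorial * z ^ u) := by
  rw [coverBound]
  rcases u with _ | _ | u
  · simp
  · simp; ring
  · have h1 : (((u + 1 + 1).choose 2 : ℕ) : ℝ) = (u + 2) * (u + 1) / 2 := by
      rw [Nat.cast_choose_two]; push_cast; ring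
    have h2 : (((u + 1 + 1).factorial : ℕ) : ℝ) = (u + 2) * ((u + 1) * u.factorial) := by
      rw [Nat.factorial_succ, Nat.factorial_succ]; push_cast; ring
    have h3 : (((u + 1).factorial : ℕ) : ℝ) = (u + 1) * u.factorial := by
      rw [Nat.factorial_succ]; push_cast; ring
    have h4 : (u.factorial : ℝ) ≠ 0 := by positivity
    have h5 : (u + 1 : ℝ) ≠ 0 := by positivity
    have h6 : (u + 2 : ℝ) ≠ 0 := by positivity
    simp only [show 2 ≤ u + 1 + 1 by omega, show 1 ≤ u + 1 + 1 by omega, if_true,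
      show u + 1 + 1 - 2 = u by omega, show u + 1 + 1 - 1 = u + 1 by omega]
    rw [h1, h2, h3]
    field_simp
    push_cast
    ring

/-- The partial sums `T` of the exponential generating function of `coverBound` satisfy
`T' ≤ A' * T` with `A = α z ^ 3 / 6 + β z ^ 2 / 2 + γ z`, so that `T ≤ exp A`. -/
theorem coverBound_mul_pow_le {α β γ : ℝ} (hα : 0 ≤ α) (hβ : 0 ≤ β) (hγ : 0 ≤ γ) (u : ℕ) {z : ℝ}
    (hz : 0 ≤ z) : coverBound α β γ u / u.factorial * z ^ u ≤
      Real.exp (α * z ^ 3 / 6 + β * z ^ 2 / 2 + γ * z) := by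
  set f : ℕ → ℝ → ℝ := fun u z => coverBound α β γ u / u.factorial * z ^ u with hf
  have hf0 : ∀ u z, 0 ≤ z → 0 ≤ f u z := fun u z hz => by
    have := coverBound_nonneg hα hβ hγ u
    simp only [hf]; positivity
  set T : ℝ → ℝ := fun z => ∑ v ∈ Finset.range (u + 1), f v z with hT
  set D : ℝ → ℝ := fun z => ∑ v ∈ Finset.range u, coverBound α β γ (v + 1) / v.factorial * z ^ v
    with hD
  have hderiv : ∀ z, HasDerivAt T (D z) z := by
    intro z
    have e : T = fun z => ∑ v ∈ Finset.range u, f (v + 1) z + f 0 z := by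
      funext z; simp only [hT]; rw [Finset.sum_range_succ']
    rw [e, ← add_zero (D z)]
    refine HasDerivAt.add (HasDerivAt.fun_sum fun v _ => ?_) ?_
    · have := ((hasDerivAt_pow (v + 1) z).const_mul
        (coverBound α β γ (v + 1) / (v + 1).factorial))
      refine this.congr_deriv ?_
      rw [Nat.factorial_succ]
      have h4 : (v.factorial : ℝ) ≠ 0 := by positivity
      have h5 : (v + 1 : ℝ) ≠ 0 := by positivity
      push_cast
      field_simp
    · simpa [hf] using hasDerivAt_const z _
  set A : ℝ → ℝ := fun z => α * z ^ 3 / 6 + β * z ^ 2 / 2 + γ * z with hA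
  have hAderiv : ∀ z, HasDerivAt A (α * z ^ 2 / 2 + β * z + γ) z := by
    intro z
    have h3 := (((hasDerivAt_pow 3 z).const_mul α).div_const 6)
    have h2 := (((hasDerivAt_pow 2 z).const_mul β).div_const 2)
    have h1 := (hasDerivAt_id z).const_mul γ
    have := (h3.add h2).add h1
    refine this.congr_deriv ?_
    norm_num
    ring
  have hDle : ∀ z, 0 ≤ z → D z ≤ (α * z ^ 2 / 2 + β * z + γ) * T z := by
    intro z hz
    have h1 : D z = ∑ v ∈ Finset.range u, (α * z ^ 2 / 2 * (if 2 ≤ v then f (v - 2) z else 0) +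
        β * z * (if 1 ≤ v then f (v - 1) z else 0) + γ * f v z) :=
      Finset.sum_congr rfl fun v _ => coverBound_succ_div_factorial α β γ z v
    rw [h1, Finset.sum_add_distrib, Finset.sum_add_distrib, ← Finset.mul_sum, ← Finset.mul_sum,
      ← Finset.mul_sum]
    have h2 := sum_range_shift_le (fun v => hf0 v z hz) 2 u
    have h3 := sum_range_shift_le (fun v => hf0 v z hz) 1 u
    have h4 : ∑ v ∈ Finset.range u, f v z ≤ T z :=
      Finset.sum_le_sum_of_subset_of_nonneg (Finset.range_mono (Nat.le_succ _))
        fun v _ _ => hf0 v z hz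
    rw [add_mul, add_mul]
    gcongr
    · exact h2.trans h4
    · exact h3.trans h4
  have hanti : AntitoneOn (fun z => T z * Real.exp (-A z)) (Set.Ici 0) := by
    have hd : ∀ z, HasDerivAt (fun z => T z * Real.exp (-A z))
        (D z * Real.exp (-A z) + T z * (Real.exp (-A z) * -(α * z ^ 2 / 2 + β * z + γ))) z :=
      fun z => (hderiv z).mul (hAderiv z).neg.exp
    refine antitoneOn_of_deriv_nonpos (convex_Ici 0)
      (fun z _ => (hd z).continuousAt.continuousWithinAt)
      (fun z _ => (hd z).differentiableAt.differentiableWithinAt) fun z hz => ?_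
    rw [interior_Ici] at hz
    rw [(hd z).deriv]
    have := mul_le_mul_of_nonneg_right (hDle z (le_of_lt hz)) (Real.exp_pos (-A z)).le
    linarith
  have h0 := hanti (Set.mem_Ici.2 le_rfl) (Set.mem_Ici.2 hz) hz
  have hT0 : T 0 = 1 := by
    simp only [hT]
    rw [Finset.sum_range_succ']
    simp [hf, coverBound]
  simp only [hT0, hA] at h0
  rw [Real.exp_neg, ← div_eq_mul_inv, div_le_iff₀ (Real.exp_pos _)] at h0
  norm_num at h0
  refine le_trans ?_ h0
  exact Finset.single_le_sum (f := fun v => f v z) (fun v _ => hf0 v z hz)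
    (Finset.self_mem_range_succ u)

variable {V : Type*} [Fintype V]

theorem binomialRandom_real_triangleVertexCount_le (p : unitInterval) {k : ℕ}
    (hk : k ≤ Fintype.card V) :
    (binomialRandom V p).real {G | triangleVertexCount G = k} ≤
      (Fintype.card V).choose k * coverBound ((p : ℝ) ^ 3) (Fintype.card V * (p : ℝ) ^ 3)
        ((Fintype.card V : ℝ) ^ 2 * (p : ℝ) ^ 3 + 6 * Fintype.card V * (p : ℝ) ^ 2) k := by
  classical
  have hsub : ({G | triangleVertexCount G = k} : Set (SimpleGraph V)) ⊆
      ⋃ S ∈ Finset.powersetCard k (Finset.univ : Finset V),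
        {G | ⊥ ≤ G ∧ ∀ x ∈ S, G.InTriangle x} := by
    intro G hG
    simp only [Set.mem_ofPred_eq] at hG
    refine Set.mem_biUnion (x := Finset.univ.filter fun v => G.InTriangle v) ?_ ?_
    · rw [Finset.mem_coe, Finset.mem_powersetCard]
      refine ⟨Finset.subset_univ _, ?_⟩
      rw [← hG, triangleVertexCount, Set.ncard_eq_toFinset_card']
      congr 1
      ext v
      simp [InTriangle]
    · simp
  refine (measureReal_mono hsub (measure_ne_top _ _)).trans ((measureReal_biUnion_finset_le _ _).trans ?_)
  refine (Finset.sum_le_card_nsmul _ _ _ fun S hS => ?_).trans_eq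
    (by rw [Finset.card_powersetCard, Finset.card_univ, nsmul_eq_mul])
  have h0 : edgeCount (⊥ : SimpleGraph V) = 0 := by simp [edgeCount]
  have := binomialRandom_real_cover_le p k S ⊥ (Finset.mem_powersetCard.1 hS).2 (by simp)
    (by omega)
  rwa [h0, pow_zero, one_mul] at this

/-- The upper bound on the probability of `k` triangle vertices, with a parameter `z` that is still
to be optimised. -/
theorem binomialRandom_real_triangleVertexCount_le_exp (p : unitInterval) (hp : 0 < (p : ℝ))
    {k : ℕ} (hk : k ≤ Fintype.card V) {z : ℝ} (hz : 0 < z) :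
    (binomialRandom V p).real {G | triangleVertexCount G = k} ≤
      (Fintype.card V).choose k * k.factorial * (p : ℝ) ^ k / z ^ k *
        Real.exp (z ^ 3 / 6 + (Fintype.card V * (p : ℝ)) * z ^ 2 / 2 +
          ((Fintype.card V * (p : ℝ)) ^ 2 + 6 * (Fintype.card V * (p : ℝ))) * z) := by
  refine (binomialRandom_real_triangleVertexCount_le p hk).trans ?_
  set n := Fintype.card V
  have h := coverBound_mul_pow_le (α := (p : ℝ) ^ 3) (β := n * (p : ℝ) ^ 3)
    (γ := (n : ℝ) ^ 2 * (p : ℝ) ^ 3 + 6 * n * (p : ℝ) ^ 2) (by positivity) (by positivity)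
    (by positivity) k (z := z / p) (by positivity)
  have e : (p : ℝ) ^ 3 * (z / p) ^ 3 / 6 + n * (p : ℝ) ^ 3 * (z / p) ^ 2 / 2 +
      ((n : ℝ) ^ 2 * (p : ℝ) ^ 3 + 6 * n * (p : ℝ) ^ 2) * (z / p) =
      z ^ 3 / 6 + (n * (p : ℝ)) * z ^ 2 / 2 + ((n * (p : ℝ)) ^ 2 + 6 * (n * (p : ℝ))) * z := by
    field_simp
  rw [e, div_pow, div_mul_div_comm, div_le_iff₀ (by positivity), ← le_div_iff₀ (by positivity)] at h
  refine (mul_le_mul_of_nonneg_left h (by positivity)).trans_eq ?_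
  ring

end SimpleGraph

/-! ### Cluster graphs -/

namespace SimpleGraph

section Cluster

variable {V : Type*}

/-- The graph whose edges are all pairs of distinct vertices of `T`. -/
def cliqueOn (T : Finset V) : SimpleGraph V where
  Adj x y := x ≠ y ∧ x ∈ T ∧ y ∈ T
  symm := ⟨fun _ _ h => ⟨h.1.symm, h.2.2, h.2.1⟩⟩
  loopless := ⟨fun _ h => h.1 rfl⟩

theorem cliqueOn_adj {T : Finset V} {x y : V} :
    (cliqueOn T).Adj x y ↔ x ≠ y ∧ x ∈ T ∧ y ∈ T := Iff.rfl

/-- `H` is a disjoint union of cliques with at least three vertices each, these cliques cover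
exactly the vertices of `U`, and `H` has at most `|U| + 5` edges. -/
structure IsCluster (U : Finset V) (H : SimpleGraph V) : Prop where
  mem_of_adj : ∀ x y, H.Adj x y → x ∈ U
  inTriangle : ∀ x ∈ U, H.InTriangle x
  trans : ∀ x y z, H.Adj x y → H.Adj y z → x ≠ z → H.Adj x z
  edgeCount_le : edgeCount H ≤ U.card + 5

/-- A lower bound for the number of cluster graphs on `u` vertices, which counts those with
triangles only, apart from a single clique with at most five vertices. -/
def clusterCount (u : ℕ) : ℕ :=
  if u < 6 then 1 else (u - 1).choose 2 * clusterCount (u - 3)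

theorem clusterCount_pos (u : ℕ) : 0 < clusterCount u := by
  induction u using Nat.strong_induction_on with
  | _ u ih =>
    rw [clusterCount]
    split_ifs with h
    · exact one_pos
    · exact Nat.mul_pos (Nat.choose_pos (by omega)) (ih _ (by omega))

theorem IsCluster.inTriangle_iff {U : Finset V} {H : SimpleGraph V} (h : IsCluster U H) {x : V} :
    H.InTriangle x ↔ x ∈ U :=
  ⟨fun ⟨_, _, hx, _⟩ => h.mem_of_adj _ _ hx, h.inTriangle x⟩

/-- The graphs that contain `H` and have no triangles other than those of `H`. -/
def trianglesWithin (H : SimpleGraph V) : Set (SimpleGraph V) :=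
  {G | H ≤ G ∧ ∀ a b c, G.Adj a b → G.Adj a c → G.Adj b c → H.Adj a b}

theorem IsCluster.inTriangle_iff_of_mem {U : Finset V} {H G : SimpleGraph V} (h : IsCluster U H)
    (hG : G ∈ trianglesWithin H) {x : V} : G.InTriangle x ↔ x ∈ U := by
  simp only [trianglesWithin, Set.mem_ofPred_eq] at hG
  refine ⟨?_, fun hx => (h.inTriangle x hx).mono hG.1⟩
  rintro ⟨u, w, h1, h2, h3⟩
  exact h.mem_of_adj _ _ (hG.2 x u w h1 h2 h3)

/-- A cluster graph consists of exactly those edges of `G ∈ trianglesWithin H` that lie in a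
triangle of `G`, so that it is determined by `G`. -/
theorem IsCluster.le_of_mem {U : Finset V} {H H' G : SimpleGraph V} (h : IsCluster U H)
    (hG : G ∈ trianglesWithin H) (hG' : G ∈ trianglesWithin H') : H ≤ H' := by
  simp only [trianglesWithin, Set.mem_ofPred_eq] at hG hG'
  intro a b hab
  obtain ⟨u, w, h1, h2, h3⟩ := h.inTriangle a (h.mem_of_adj a b hab)
  by_cases hbu : b = u
  · subst hbu
    exact hG'.2 a b w (hG.1 h1) (hG.1 h2) (hG.1 h3)
  · exact hG'.2 a b u (hG.1 hab) (hG.1 h1) (hG.1 (h.trans b a u hab.symm h1 hbu))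

variable [Fintype V]

theorem two_mul_edgeCount_cliqueOn (T : Finset V) :
    2 * edgeCount (cliqueOn T) = T.card * T.card - T.card := by
  classical
  rw [← card_filter_adj, ← Finset.offDiag_card]
  congr 1
  ext x
  simp only [cliqueOn_adj, Finset.mem_filter, Finset.mem_univ, true_and, Finset.mem_offDiag]
  tauto

theorem isCluster_cliqueOn {U : Finset V} (h3 : 3 ≤ U.card) (h5 : U.card ≤ 5) :
    IsCluster U (cliqueOn U) where
  mem_of_adj x y h := h.2.1
  inTriangle x hx := by
    classical
    have : 1 < (U.erase x).card := by rw [Finset.card_erase_of_mem hx]; omega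
    obtain ⟨u, hu, w, hw, huw⟩ := Finset.one_lt_card.1 this
    rw [Finset.mem_erase] at hu hw
    exact ⟨u, w, ⟨hu.1.symm, hx, hu.2⟩, ⟨hw.1.symm, hx, hw.2⟩, ⟨huw, hu.2, hw.2⟩⟩
  trans x y z hxy hyz hxz := ⟨hxz, hxy.2.1, hyz.2.2⟩
  edgeCount_le := by
    have := two_mul_edgeCount_cliqueOn U
    interval_cases h : U.card <;> omega

theorem IsCluster.sup_cliqueOn [DecidableEq V] {U T : Finset V} {H : SimpleGraph V} (hTU : T ⊆ U)
    (hT : T.card = 3) (h : IsCluster (U \ T) H) : IsCluster U (H ⊔ cliqueOn T) where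
  mem_of_adj x y hxy := by
    rcases hxy with hxy | hxy
    · exact (Finset.mem_sdiff.1 (h.mem_of_adj x y hxy)).1
    · exact hTU hxy.2.1
  inTriangle x hx := by
    by_cases hxT : x ∈ T
    · exact ((isCluster_cliqueOn (by omega) (by omega)).inTriangle x hxT).mono le_sup_right
    · exact (h.inTriangle x (Finset.mem_sdiff.2 ⟨hx, hxT⟩)).mono le_sup_left
  trans x y z hxy hyz hxz := by
    rcases hxy with hxy | hxy <;> rcases hyz with hyz | hyz
    · exact Or.inl (h.trans x y z hxy hyz hxz)
    · exact absurd hyz.2.1 (Finset.mem_sdiff.1 (h.mem_of_adj y x hxy.symm)).2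
    · exact absurd hxy.2.2 (Finset.mem_sdiff.1 (h.mem_of_adj y z hyz)).2
    · exact Or.inr ⟨hxz, hxy.2.1, hyz.2.2⟩
  edgeCount_le := by
    have h1 := edgeCount_sup_add_edgeCount_inf H (cliqueOn T)
    have h2 := two_mul_edgeCount_cliqueOn T
    have h3 := h.edgeCount_le
    rw [Finset.card_sdiff_of_subset hTU] at h3
    have h4 := Finset.card_le_card hTU
    rw [hT] at h2 h3 h4
    omega

theorem clusterCount_le_ncard (u : ℕ) : 3 ≤ u → ∀ U : Finset V, U.card = u →
    clusterCount u ≤ {H | IsCluster U H}.ncard := by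
  classical
  induction u using Nat.strong_induction_on with
  | _ u ih =>
    intro hu U hU
    rw [clusterCount]
    split_ifs with h6
    · rw [Nat.succ_le_iff, Set.ncard_pos]
      exact ⟨cliqueOn U, isCluster_cliqueOn (by omega) (by omega)⟩
    · obtain ⟨v, hv⟩ : U.Nonempty := by rw [← Finset.card_pos]; omega
      have hUv : (U.erase v).card = u - 1 := by rw [Finset.card_erase_of_mem hv]; omega
      set S := (Finset.powersetCard 2 (U.erase v)).sigma
        (fun s => Finset.univ.filter fun H => IsCluster (U \ insert v s) H) with hS
      have hT : ∀ s ∈ Finset.powersetCard 2 (U.erase v), insert v s ⊆ U ∧ (insert v s).card = 3 ∧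
          v ∉ s := by
        intro s hs
        rw [Finset.mem_powersetCard] at hs
        have hvs : v ∉ s := fun h => by simpa using hs.1 h
        refine ⟨Finset.insert_subset hv (hs.1.trans (Finset.erase_subset _ _)), ?_, hvs⟩
        rw [Finset.card_insert_of_notMem hvs, hs.2]
      have hcard : (u - 1).choose 2 * clusterCount (u - 3) ≤ S.card := by
        rw [hS, Finset.card_sigma, ← hUv, ← Finset.card_powersetCard, ← smul_eq_mul]
        refine Finset.card_nsmul_le_sum _ _ _ fun s hs => ?_
        have h3 := hT s hs
        refine (ih (u - 3) (by omega) (by omega) (U \ insert v s)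
          (by rw [Finset.card_sdiff_of_subset h3.1, h3.2.1, hU])).trans_eq ?_
        rw [Set.ncard_eq_toFinset_card']
        congr 1
        ext; simp
      refine hcard.trans ?_
      rw [Set.ncard_eq_toFinset_card']
      refine Finset.card_le_card_of_injOn (fun x => x.2 ⊔ cliqueOn (insert v x.1)) ?_ ?_
      · rintro ⟨s, H⟩ hx
        simp only [hS, Finset.coe_sigma, Set.mem_sigma_iff, Finset.mem_coe, Finset.mem_filter,
          Finset.mem_univ, true_and] at hx
        have h3 := hT s hx.1
        simp only [Finset.mem_coe, Set.mem_toFinset, Set.mem_ofPred_eq]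
        exact hx.2.sup_cliqueOn h3.1 h3.2.1
      · rintro ⟨s, H⟩ hx ⟨s', H'⟩ hx' heq
        simp only [hS, Finset.coe_sigma, Set.mem_sigma_iff, Finset.mem_coe, Finset.mem_filter,
          Finset.mem_univ, true_and] at hx hx' heq
        -- the new triangle is recovered as the neighbourhood of `v`
        have hnb : ∀ (s : Finset V) (H : SimpleGraph V), v ∉ s → IsCluster (U \ insert v s) H →
            ∀ y, (H ⊔ cliqueOn (insert v s)).Adj v y ↔ y ∈ s := by
          intro s H hvs hH y
          rw [sup_adj, cliqueOn_adj]
          have : ¬ H.Adj v y := fun h => by simpa using hH.mem_of_adj _ _ h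
          have h2 : y ∈ s → v ≠ y := fun hy h => hvs (h ▸ hy)
          simp only [this, Finset.mem_insert, false_or, true_or, true_and]
          constructor
          · rintro ⟨h1, rfl | h2⟩
            exacts [absurd rfl h1, h2]
          · exact fun hy => ⟨h2 hy, Or.inr hy⟩
        have hs : s = s' := by
          ext y
          rw [← hnb s H (hT s hx.1).2.2 hx.2 y, heq, hnb s' H' (hT s' hx'.1).2.2 hx'.2 y]
        subst hs
        have hrest : ∀ (H : SimpleGraph V), IsCluster (U \ insert v s) H →
            ∀ x y, H.Adj x y ↔ (H ⊔ cliqueOn (insert v s)).Adj x y ∧ x ∉ insert v s := by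
          intro H hH x y
          rw [sup_adj, cliqueOn_adj]
          have : H.Adj x y → x ∉ insert v s := fun h =>
            (Finset.mem_sdiff.1 (hH.mem_of_adj _ _ h)).2
          tauto
        have hH : H = H' := by
          ext x y
          rw [hrest H hx.2, heq, ← hrest H' hx'.2]
        rw [hH]

/-- For transitive `H`, every triangle that is not in `H` needs two or three further edges, and
there are at most `2 e(H) n` and `n ^ 3` triangles of these two kinds. Harris' inequality thus
bounds from below the probability that none of them appears. -/
theorem le_binomialRandom_real_trianglesWithin (p : unitInterval) (hp : 0 < (p : ℝ))
    {H : SimpleGraph V} (htrans : ∀ x y z, H.Adj x y → H.Adj y z → x ≠ z → H.Adj x z) :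
    (p : ℝ) ^ edgeCount H * ((1 - (p : ℝ) ^ 3) ^ (Fintype.card V ^ 3) *
        (1 - (p : ℝ) ^ 2) ^ (2 * edgeCount H * Fintype.card V)) ≤
      (binomialRandom V p).real (trianglesWithin H) := by
  classical
  set n := Fintype.card V
  have hsymm : ∀ x y, ¬ H.Adj x y → ¬ H.Adj y x := fun x y h h' => h h'.symm
  set s2 : Finset ((V × V) × V) := Finset.univ.filter fun x => H.Adj x.1.1 x.1.2 ∧ x.2 ≠ x.1.1 ∧
    x.2 ≠ x.1.2 ∧ ¬ H.Adj x.2 x.1.1 ∧ ¬ H.Adj x.2 x.1.2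
  set s3 : Finset ((V × V) × V) := Finset.univ.filter fun x => ¬ H.Adj x.1.1 x.1.2 ∧
    x.1.1 ≠ x.1.2 ∧ x.2 ≠ x.1.1 ∧ x.2 ≠ x.1.2 ∧ ¬ H.Adj x.2 x.1.1 ∧ ¬ H.Adj x.2 x.1.2
  have hdisj : Disjoint s3 s2 := by
    rw [Finset.disjoint_left]
    intro x hx hx'
    simp only [s2, s3, Finset.mem_filter] at hx hx'
    exact hx.2.1 hx'.2.1
  have hs2 : s2.card ≤ 2 * edgeCount H * n := by
    rw [← card_filter_adj, show n = (Finset.univ : Finset V).card from rfl,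
      ← Finset.card_product]
    refine Finset.card_le_card fun x hx => ?_
    simp only [s2, Finset.mem_filter, Finset.mem_product, Finset.mem_univ, true_and, and_true]
      at hx ⊢
    exact hx.1
  have hs3 : s3.card ≤ n ^ 3 := by
    refine (Finset.card_le_univ _).trans_eq ?_
    rw [Fintype.card_prod, Fintype.card_prod]
    ring
  set d : (V × V) × V → ℕ := fun x => if H.Adj x.1.1 x.1.2 then 2 else 3 with hd
  have key := pow_mul_prod_le_binomialRandom_real p hp H (s3 ∪ s2)
    (fun x => triangleGraph x.2 x.1.1 x.1.2) d (by
      rintro ⟨⟨b, c⟩, a⟩ hx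
      simp only [s2, s3, Finset.mem_union, Finset.mem_filter, Finset.mem_univ, true_and] at hx
      rcases hx with ⟨h1, h2, h3, h4, h5, h6⟩ | ⟨h1, h2, h3, h4, h5⟩
      · simp only [hd, h1, if_false]
        exact (edgeCount_sup_triangleGraph_of_not_adj h3 h4 h2 h5 h6 h1).ge
      · simp only [hd, h1, if_true]
        exact (edgeCount_sup_triangleGraph_of_adj h2 h3 h4 h5 h1).ge)
  have hp1 : (p : ℝ) ≤ 1 := p.2.2
  have q2 : 0 ≤ 1 - (p : ℝ) ^ 2 := by have := pow_le_one₀ (n := 2) hp.le hp1; linarith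
  have q3 : 0 ≤ 1 - (p : ℝ) ^ 3 := by have := pow_le_one₀ (n := 3) hp.le hp1; linarith
  have q2' : 1 - (p : ℝ) ^ 2 ≤ 1 := by have : 0 ≤ (p : ℝ) ^ 2 := by positivity
                                       linarith
  have q3' : 1 - (p : ℝ) ^ 3 ≤ 1 := by have : 0 ≤ (p : ℝ) ^ 3 := by positivity
                                       linarith
  rw [Finset.prod_union hdisj] at key
  have e3 : ∏ x ∈ s3, (1 - (p : ℝ) ^ d x) = (1 - (p : ℝ) ^ 3) ^ s3.card := by
    refine Finset.prod_eq_pow_card fun x hx => ?_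
    simp only [s3, Finset.mem_filter] at hx
    simp [hd, hx.2.1]
  have e2 : ∏ x ∈ s2, (1 - (p : ℝ) ^ d x) = (1 - (p : ℝ) ^ 2) ^ s2.card := by
    refine Finset.prod_eq_pow_card fun x hx => ?_
    simp only [s2, Finset.mem_filter] at hx
    simp [hd, hx.2.1]
  rw [e2, e3] at key
  refine le_trans ?_ (key.trans (measureReal_mono ?_))
  · refine mul_le_mul_of_nonneg_left (mul_le_mul ?_ ?_ ?_ ?_) (by positivity)
    · exact pow_le_pow_of_le_one q3 q3' hs3
    · exact pow_le_pow_of_le_one q2 q2' hs2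
    · exact pow_nonneg q2 _
    · exact pow_nonneg q3 _
  · intro G hG
    simp only [trianglesWithin, Set.mem_ofPred_eq] at hG ⊢
    refine ⟨hG.1, fun a b c hab hac hbc => ?_⟩
    by_contra hH
    by_cases h1 : H.Adj a c <;> by_cases h2 : H.Adj b c
    · exact hH (htrans a c b h1 h2.symm hab.ne)
    · refine hG.2 ((a, c), b) ?_ ((triangleGraph_le_iff hab.ne' hbc.ne hac.ne).2
        ⟨hab.symm, hbc, hac⟩)
      simp [s2, h1, hab.ne', hbc.ne, h2, hsymm _ _ hH]
    · refine hG.2 ((b, c), a) ?_ ((triangleGraph_le_iff hab.ne hac.ne hbc.ne).2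
        ⟨hab, hac, hbc⟩)
      simp [s2, h1, hab.ne, hac.ne, h2, hH]
    · refine hG.2 ((b, c), a) ?_ ((triangleGraph_le_iff hab.ne hac.ne hbc.ne).2
        ⟨hab, hac, hbc⟩)
      simp [s3, h1, hab.ne, hac.ne, h2, hH, hbc.ne]

theorem le_binomialRandom_real_triangleVertexCount (p : unitInterval) (hp : 0 < (p : ℝ)) {k : ℕ}
    (hk : k ≤ Fintype.card V) (hk3 : 3 ≤ k) :
    (Fintype.card V).choose k * clusterCount k * (p : ℝ) ^ (k + 5) *
      ((1 - (p : ℝ) ^ 3) ^ (Fintype.card V ^ 3) *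
        (1 - (p : ℝ) ^ 2) ^ (2 * (Fintype.card V + 5) * Fintype.card V)) ≤
      (binomialRandom V p).real {G | triangleVertexCount G = k} := by
  classical
  set n := Fintype.card V
  have hp1 : (p : ℝ) ≤ 1 := p.2.2
  have q2 : 0 ≤ 1 - (p : ℝ) ^ 2 := by have := pow_le_one₀ (n := 2) hp.le hp1; linarith
  have q3 : 0 ≤ 1 - (p : ℝ) ^ 3 := by have := pow_le_one₀ (n := 3) hp.le hp1; linarith
  have q2' : 1 - (p : ℝ) ^ 2 ≤ 1 := by have : 0 ≤ (p : ℝ) ^ 2 := by positivity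
                                       linarith
  set F : Finset (SimpleGraph V) := (Finset.powersetCard k (Finset.univ : Finset V)).biUnion
    (fun U => Finset.univ.filter fun H => IsCluster U H) with hF
  have hFmem : ∀ H ∈ F, ∃ U : Finset V, U.card = k ∧ IsCluster U H := by
    intro H hH
    simp only [hF, Finset.mem_biUnion, Finset.mem_powersetCard, Finset.mem_filter] at hH
    obtain ⟨U, hU, hH⟩ := hH
    exact ⟨U, hU.2, hH.2⟩
  have hFcard : n.choose k * clusterCount k ≤ F.card := by
    rw [hF, Finset.card_biUnion, show n = (Finset.univ : Finset V).card from rfl,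
      ← Finset.card_powersetCard, ← smul_eq_mul]
    · refine Finset.card_nsmul_le_sum _ _ _ fun U hU => ?_
      refine (clusterCount_le_ncard k hk3 U (Finset.mem_powersetCard.1 hU).2).trans_eq ?_
      rw [Set.ncard_eq_toFinset_card']
      congr 1
      ext; simp
    · intro U _ U' _ hne
      rw [Function.onFun, Finset.disjoint_left]
      intro H hH hH'
      simp only [Finset.mem_filter, Finset.mem_univ, true_and] at hH hH'
      refine hne (Finset.ext fun x => ?_)
      rw [← hH.inTriangle_iff, hH'.inTriangle_iff]
  set Y : ℝ := (p : ℝ) ^ (k + 5) * ((1 - (p : ℝ) ^ 3) ^ (n ^ 3) *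
    (1 - (p : ℝ) ^ 2) ^ (2 * (n + 5) * n)) with hY
  have hY0 : 0 ≤ Y :=
    mul_nonneg (by positivity) (mul_nonneg (pow_nonneg q3 _) (pow_nonneg q2 _))
  have hterm : ∀ H ∈ F, Y ≤ (binomialRandom V p).real (trianglesWithin H) := by
    intro H hH
    obtain ⟨U, hU, hHU⟩ := hFmem H hH
    refine le_trans ?_ (le_binomialRandom_real_trianglesWithin p hp hHU.trans)
    have he := hHU.edgeCount_le
    refine mul_le_mul ?_ (mul_le_mul_of_nonneg_left ?_ (pow_nonneg q3 _))
      (mul_nonneg (pow_nonneg q3 _) (pow_nonneg q2 _)) (by positivity)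
    · exact pow_le_pow_of_le_one hp.le hp1 (by omega)
    · refine pow_le_pow_of_le_one q2 q2' ?_
      gcongr
      omega
  have hunion : (⋃ H ∈ F, trianglesWithin H) ⊆ {G | triangleVertexCount G = k} := by
    intro G hG
    simp only [Set.mem_iUnion] at hG
    obtain ⟨H, hH, hG⟩ := hG
    obtain ⟨U, hU, hHU⟩ := hFmem H hH
    simp only [Set.mem_ofPred_eq]
    rw [triangleVertexCount, ← hU, ← Set.ncard_coe_finset]
    congr 1
    ext x
    rw [Finset.mem_coe, ← hHU.inTriangle_iff_of_mem hG]
    simp [InTriangle]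
  calc _ = ((n.choose k * clusterCount k : ℕ) : ℝ) * Y := by rw [hY]; push_cast; ring
    _ ≤ (F.card : ℝ) * Y := by gcongr
    _ ≤ ∑ H ∈ F, (binomialRandom V p).real (trianglesWithin H) := by
      rw [← nsmul_eq_mul]
      exact Finset.card_nsmul_le_sum _ _ _ hterm
    _ = (binomialRandom V p).real (⋃ H ∈ F, trianglesWithin H) := by
      rw [measureReal_biUnion_finset]
      · intro H hH H' hH' hne
        rw [Function.onFun, Set.disjoint_left]
        intro G hG hG'
        obtain ⟨U, -, hHU⟩ := hFmem H hH
        obtain ⟨U', -, hHU'⟩ := hFmem H' hH'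
        exact hne (le_antisymm (hHU.le_of_mem hG hG') (hHU'.le_of_mem hG' hG))
      · exact fun H _ => (Set.toFinite _).measurableSet
    _ ≤ _ := measureReal_mono hunion

end Cluster

end SimpleGraph

/-! ### Asymptotics of the number of triangle vertices -/

namespace SimpleGraph

theorem factorial_mul_exp_le {m : ℕ} (hm : 1 ≤ m) :
    (m.factorial : ℝ) * Real.exp m ≤ Real.exp 1 * (m : ℝ) ^ (m + 1) := by
  induction m, hm using Nat.le_induction with
  | base => simp
  | succ m hm ih =>
    have hm0 : (0 : ℝ) < m := by exact_mod_cast hm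
    have h1 : Real.exp 1 * (m : ℝ) ^ (m + 1) ≤ ((m : ℝ) + 1) ^ (m + 1) := by
      have h2 : (1 : ℝ) ≤ (m + 1 : ℕ) * Real.log ((m + 1) / m) := by
        have := Real.one_sub_inv_le_log_of_pos (show (0 : ℝ) < (m + 1) / m by positivity)
        calc (1 : ℝ) = (m + 1 : ℕ) * (1 - ((m + 1 : ℝ) / m)⁻¹) := by push_cast; field_simp; ring
          _ ≤ _ := by gcongr
      have h3 := Real.exp_le_exp.2 h2
      rw [← Real.log_pow, Real.exp_log (by positivity), div_pow, le_div_iff₀ (by positivity)] at h3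
      exact h3
    rw [Nat.factorial_succ]
    push_cast
    rw [Real.exp_add]
    calc ((m : ℝ) + 1) * m.factorial * (Real.exp m * Real.exp 1)
        = (m + 1) * Real.exp 1 * (m.factorial * Real.exp m) := by ring
      _ ≤ (m + 1) * Real.exp 1 * (Real.exp 1 * (m : ℝ) ^ (m + 1)) := by gcongr
      _ ≤ (m + 1) * Real.exp 1 * ((m : ℝ) + 1) ^ (m + 1) := by gcongr
      _ = _ := by ring

theorem factorial_le_mul_clusterCount (k : ℕ) :
    k.factorial ≤ 120 * 6 ^ (k / 3 + 1) * (k / 3 + 1).factorial * clusterCount k := by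
  induction k using Nat.strong_induction_on with
  | _ k ih =>
    rw [clusterCount]
    split_ifs with h
    · have h1 : k.factorial ≤ 120 := Nat.factorial_le (show k ≤ 5 by omega)
      have h2 : 0 < 6 ^ (k / 3 + 1) * (k / 3 + 1).factorial := by positivity
      nlinarith
    · obtain ⟨j, rfl⟩ : ∃ j, k = j + 3 := ⟨k - 3, by omega⟩
      have h3 := ih j (by omega)
      have hc : (j + 3 - 1).choose 2 * 2 = (j + 2) * (j + 1) := by
        rw [show j + 3 - 1 = j + 2 by omega, Nat.choose_two_right,
          Nat.div_mul_cancel (Nat.even_mul_pred_self _).two_dvd]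
        rfl
      rw [show j + 3 - 3 = j by omega, show (j + 3) / 3 + 1 = j / 3 + 1 + 1 by omega]
      rw [Nat.factorial_succ (j / 3 + 1), Nat.factorial_succ, Nat.factorial_succ, Nat.factorial_succ]
      have hj : j + 3 ≤ 3 * (j / 3 + 1 + 1) := by omega
      set M := j / 3 + 1
      calc (j + 2 + 1) * ((j + 1 + 1) * ((j + 1) * j.factorial))
          ≤ (3 * (M + 1)) * ((j + 2) * ((j + 1) * (120 * 6 ^ M * M.factorial * clusterCount j))) := by
            gcongr
        _ = 120 * 6 ^ M * M.factorial * clusterCount j * 3 * (M + 1) * ((j + 2) * (j + 1)) := by ring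
        _ = _ := by rw [← hc]; ring

/-- The optimal choice `z ^ 3 = 6 M ≈ 2 k` in the upper bound makes the upper bound agree with the
number of cluster graphs, up to polynomial factors. -/
theorem factorial_div_pow_mul_exp_le (k : ℕ) {z : ℝ} (hz : 0 < z)
    (hz3 : z ^ 3 = 6 * (k / 3 + 1 : ℕ)) :
    k.factorial / z ^ k * Real.exp (z ^ 3 / 6) ≤
      clusterCount k * (720 * Real.exp 1 * ((k / 3 + 1 : ℕ) : ℝ) ^ 2) := by
  have hk : (k.factorial : ℝ) ≤
      120 * 6 ^ (k / 3 + 1) * (k / 3 + 1).factorial * clusterCount k := by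
    exact_mod_cast factorial_le_mul_clusterCount k
  have hle : 3 * (k / 3) ≤ k := by omega
  set m := k / 3
  have hM := factorial_mul_exp_le (m := m + 1) (by omega)
  have hz1 : 1 ≤ z := by
    by_contra h
    have h1 : z ^ 3 ≤ 1 := pow_le_one₀ hz.le (le_of_not_ge h)
    rw [hz3] at h1
    push_cast at h1
    have : (0 : ℝ) ≤ m := by positivity
    linarith
  have hzk : (6 * ((m + 1 : ℕ) : ℝ)) ^ m ≤ z ^ k := by
    rw [← hz3, ← pow_mul]
    exact pow_le_pow_right₀ hz1 hle
  have e1 : z ^ 3 / 6 = (m + 1 : ℕ) := by rw [hz3]; ring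
  rw [e1, div_mul_eq_mul_div, div_le_iff₀ (by positivity)]
  calc (k.factorial : ℝ) * Real.exp (m + 1 : ℕ)
      ≤ (120 * 6 ^ (m + 1) * (m + 1).factorial * clusterCount k) * Real.exp (m + 1 : ℕ) := by gcongr
    _ = 120 * 6 ^ (m + 1) * clusterCount k * ((m + 1).factorial * Real.exp (m + 1 : ℕ)) := by ring
    _ ≤ 120 * 6 ^ (m + 1) * clusterCount k * (Real.exp 1 * ((m + 1 : ℕ) : ℝ) ^ (m + 1 + 1)) := by
      gcongr
    _ = clusterCount k * (720 * Real.exp 1 * ((m + 1 : ℕ) : ℝ) ^ 2) *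
        (6 * ((m + 1 : ℕ) : ℝ)) ^ m := by
      rw [mul_pow]; ring
    _ ≤ _ := by gcongr

/-- The part of the probability of `k` triangle vertices in `G(n, μ / n)` that does not depend on
`μ`, up to factors that are subexponential in `n`. -/
noncomputable def clusterWeight (n k : ℕ) : ℝ := n.choose k * clusterCount k / (n : ℝ) ^ k

theorem clusterWeight_pos {n k : ℕ} (hk : k ≤ n) (hn : 0 < n) : 0 < clusterWeight n k := by
  have h1 := Nat.choose_pos hk
  have h2 := clusterCount_pos k
  unfold clusterWeight
  positivity

theorem neg_two_mul_le_log_one_sub {x : ℝ} (h0 : 0 ≤ x) (h : x ≤ 1 / 2) :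
    -(2 * x) ≤ Real.log (1 - x) := by
  refine le_trans ?_ (Real.one_sub_inv_le_log_of_pos (by linarith))
  rw [le_sub_iff_add_le, ← le_sub_iff_add_le', inv_le_iff_one_le_mul₀ (by linarith)]
  nlinarith

theorem log_triangleVertexCount_le {n : ℕ} (p : unitInterval) (hp : 0 < (p : ℝ)) {k : ℕ}
    (hk : k ≤ n) (hn : 2 ≤ n)
    (hP : 0 < (binomialRandom (Fin n) p).real {G | triangleVertexCount G = k}) :
    Real.log ((binomialRandom (Fin n) p).real {G | triangleVertexCount G = k}) -
        Real.log (clusterWeight n k) ≤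
      k * Real.log (n * p) + Real.log (720 * Real.exp 1) + 2 * Real.log n +
        ((n * p) ^ 2 + 7 * (n * p)) * (6 * n : ℝ) ^ (2 / 3 : ℝ) := by
  have hn0 : (0 : ℝ) < n := by exact_mod_cast (by omega : 0 < n)
  have hR := clusterWeight_pos hk (by omega)
  set μ : ℝ := n * p with hμ
  have hμ0 : 0 < μ := by positivity
  set M : ℕ := k / 3 + 1 with hM
  have hMn : (M : ℝ) ≤ n := by exact_mod_cast (by omega : M ≤ n)
  have hM1 : (1 : ℝ) ≤ M := by exact_mod_cast (by omega : 1 ≤ M)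
  set z : ℝ := (6 * M : ℝ) ^ (1 / 3 : ℝ) with hz
  have hz0 : 0 < z := by positivity
  have hz3 : z ^ 3 = 6 * M := by
    rw [hz, ← Real.rpow_natCast, ← Real.rpow_mul (by positivity)]
    norm_num
  have hz2 : z ^ 2 ≤ (6 * n : ℝ) ^ (2 / 3 : ℝ) := by
    rw [hz, ← Real.rpow_natCast, ← Real.rpow_mul (by positivity)]
    norm_num
    exact Real.rpow_le_rpow (by positivity) (by linarith) (by norm_num)
  have hz1 : 1 ≤ z := Real.one_le_rpow (by linarith) (by norm_num)
  have h1 := binomialRandom_real_triangleVertexCount_le_exp (V := Fin n) p hp (k := k)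
    (by simpa using hk) hz0
  rw [Fintype.card_fin, ← hμ] at h1
  have h2 := factorial_div_pow_mul_exp_le k hz0 hz3
  rw [← hM] at h2
  have hc := clusterCount_pos k
  have h3 : (binomialRandom (Fin n) p).real {G | triangleVertexCount G = k} ≤
      clusterWeight n k * μ ^ k * (720 * Real.exp 1 * (M : ℝ) ^ 2) *
        Real.exp (μ * z ^ 2 / 2 + (μ ^ 2 + 6 * μ) * z) := by
    refine h1.trans ?_
    rw [add_assoc, Real.exp_add]
    calc _ = n.choose k * (p : ℝ) ^ k * (k.factorial / z ^ k * Real.exp (z ^ 3 / 6)) *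
          Real.exp (μ * z ^ 2 / 2 + (μ ^ 2 + 6 * μ) * z) := by ring
      _ ≤ n.choose k * (p : ℝ) ^ k * (clusterCount k * (720 * Real.exp 1 * (M : ℝ) ^ 2)) *
          Real.exp (μ * z ^ 2 / 2 + (μ ^ 2 + 6 * μ) * z) := by gcongr
      _ = _ := by
        rw [clusterWeight, hμ]
        field_simp
        ring
  clear_value μ
  have h4 := Real.log_le_log hP h3
  rw [Real.log_mul (by positivity) (by positivity), Real.log_mul (by positivity) (by positivity),
    Real.log_mul (by positivity) (by positivity), Real.log_exp, Real.log_pow,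
    Real.log_mul (by positivity) (by positivity), Real.log_pow] at h4
  have h5 : Real.log M ≤ Real.log n := Real.log_le_log (by linarith) hMn
  have h6 : μ * z ^ 2 / 2 + (μ ^ 2 + 6 * μ) * z ≤
      (μ ^ 2 + 7 * μ) * (6 * n : ℝ) ^ (2 / 3 : ℝ) := by
    have h7 : z ≤ z ^ 2 := by nlinarith
    calc _ ≤ μ * z ^ 2 + (μ ^ 2 + 6 * μ) * z ^ 2 := by
          gcongr
          have : 0 ≤ μ * z ^ 2 := by positivity
          linarith
      _ = (μ ^ 2 + 7 * μ) * z ^ 2 := by ring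
      _ ≤ _ := by gcongr
  push_cast at h4
  linarith

theorem le_log_triangleVertexCount {n : ℕ} (p : unitInterval) (hp : 0 < (p : ℝ))
    (hp2 : (p : ℝ) ≤ 1 / 2) {k : ℕ} (hk : k ≤ n) (hk3 : 3 ≤ k) :
    0 < (binomialRandom (Fin n) p).real {G | triangleVertexCount G = k} ∧
    k * Real.log (n * p) + 5 * (Real.log (n * p) - Real.log n) - 2 * (n * p) ^ 3 -
        24 * (n * p) ^ 2 ≤
      Real.log ((binomialRandom (Fin n) p).real {G | triangleVertexCount G = k}) -
        Real.log (clusterWeight n k) := by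
  have hn0 : (0 : ℝ) < n := by exact_mod_cast (by omega : 0 < n)
  have hn1 : (1 : ℝ) ≤ n := by exact_mod_cast (by omega : 1 ≤ n)
  have hR := clusterWeight_pos hk (by omega)
  have h1 := le_binomialRandom_real_triangleVertexCount (V := Fin n) p hp (k := k)
    (by simpa using hk) hk3
  rw [Fintype.card_fin] at h1
  have hp22 : (p : ℝ) ^ 2 ≤ 1 / 2 := by nlinarith
  have hp23 : (p : ℝ) ^ 3 ≤ 1 / 2 := by
    have : (p : ℝ) ^ 3 = p * p ^ 2 := by ring
    nlinarith
  have q2 : 0 < 1 - (p : ℝ) ^ 2 := by linarith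
  have q3 : 0 < 1 - (p : ℝ) ^ 3 := by linarith
  have hc := clusterCount_pos k
  have hch := Nat.choose_pos hk
  have e : (n.choose k : ℝ) * clusterCount k * (p : ℝ) ^ (k + 5) =
      clusterWeight n k * (n * p) ^ k * (p : ℝ) ^ 5 := by
    rw [clusterWeight, mul_pow (n : ℝ)]
    field_simp
    ring
  rw [e] at h1
  set a2 := (1 - (p : ℝ) ^ 2) ^ (2 * (n + 5) * n) with ha2
  set a3 := (1 - (p : ℝ) ^ 3) ^ (n ^ 3) with ha3
  have ha2' : 0 < a2 := by positivity
  have ha3' : 0 < a3 := by positivity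
  have hpos : 0 < clusterWeight n k * (n * p) ^ k * (p : ℝ) ^ 5 * (a3 * a2) := by positivity
  refine ⟨hpos.trans_le h1, ?_⟩
  have h4 := Real.log_le_log hpos h1
  rw [Real.log_mul (by positivity) (by positivity), Real.log_mul (by positivity) (by positivity),
    Real.log_mul (by positivity) (by positivity), Real.log_mul ha3'.ne' ha2'.ne',
    Real.log_pow, Real.log_pow, ha2, ha3, Real.log_pow, Real.log_pow] at h4
  have h5 : Real.log p = Real.log (n * p) - Real.log n := by
    rw [Real.log_mul (by positivity) (by positivity)]; ring
  have h6 := mul_le_mul_of_nonneg_left (neg_two_mul_le_log_one_sub (by positivity) hp23)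
    (show (0 : ℝ) ≤ (n ^ 3 : ℕ) by positivity)
  have h7 := mul_le_mul_of_nonneg_left (neg_two_mul_le_log_one_sub (by positivity) hp22)
    (show (0 : ℝ) ≤ (2 * (n + 5) * n : ℕ) by positivity)
  have h8 : (2 * (n + 5) * n : ℝ) * (2 * (p : ℝ) ^ 2) ≤ 24 * (n * p) ^ 2 := by
    have : (2 * (n + 5) * n : ℝ) ≤ 12 * n ^ 2 := by nlinarith
    calc _ ≤ (12 * n ^ 2 : ℝ) * (2 * (p : ℝ) ^ 2) := by gcongr
      _ = _ := by ring
  have h9 : (n : ℝ) ^ 3 * (2 * (p : ℝ) ^ 3) = 2 * (n * p) ^ 3 := by ring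
  push_cast at h4 h6 h7
  rw [h5] at h4
  linarith

theorem eventually_le_of_abs_sub_lt {a : ℝ} (ha1 : a ≤ 1) {k : ℕ → ℕ}
    (hk : ∀ n : ℕ, |(k n : ℝ) - a * n| < 1) : ∀ᶠ n in atTop, k n ≤ n := by
  rcases ha1.eq_or_lt with rfl | ha
  · refine Eventually.of_forall fun n => ?_
    have := (abs_lt.1 (hk n)).2
    have h : (k n : ℝ) < (n + 1 : ℕ) := by push_cast; linarith
    exact Nat.lt_succ_iff.1 (by exact_mod_cast h)
  · filter_upwards [(tendsto_natCast_atTop_atTop (R := ℝ)).eventually_ge_atTop (1 / (1 - a))]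
      with n hn
    have := (abs_lt.1 (hk n)).2
    rw [div_le_iff₀ (by linarith)] at hn
    have h : (k n : ℝ) ≤ n := by linarith
    exact_mod_cast h

theorem eventually_three_le_of_abs_sub_lt {a : ℝ} (ha0 : 0 < a) {k : ℕ → ℕ}
    (hk : ∀ n : ℕ, |(k n : ℝ) - a * n| < 1) : ∀ᶠ n in atTop, 3 ≤ k n := by
  filter_upwards [(tendsto_natCast_atTop_atTop (R := ℝ)).eventually_ge_atTop (4 / a)] with n hn
  have := (abs_lt.1 (hk n)).1
  rw [div_le_iff₀ ha0] at hn
  have h : (3 : ℝ) ≤ k n := by linarith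
  exact_mod_cast h

theorem tendsto_div_of_abs_sub_lt {a : ℝ} {k : ℕ → ℕ}
    (hk : ∀ n : ℕ, |(k n : ℝ) - a * n| < 1) :
    Tendsto (fun n : ℕ => (k n : ℝ) / n) atTop (𝓝 a) := by
  rw [tendsto_iff_norm_sub_tendsto_zero]
  refine squeeze_zero' (Eventually.of_forall fun n => norm_nonneg _) ?_
    tendsto_one_div_atTop_nhds_zero_nat
  filter_upwards [eventually_gt_atTop 0] with n hn
  have hn0 : (0 : ℝ) < n := by exact_mod_cast hn
  rw [Real.norm_eq_abs, show (k n : ℝ) / n - a = (k n - a * n) / n by field_simp, abs_div,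
    abs_of_pos hn0]
  gcongr
  exact (hk n).le

/-- In `G(n, μ / n)`, the probability of `k n ≈ a n` triangle vertices depends on `μ` through the
factor `μ ^ (a n)` only, up to subexponential factors. -/
theorem tendsto_log_triangleVertexCount {a : ℝ} (ha0 : 0 < a) (ha1 : a ≤ 1) {k : ℕ → ℕ}
    (hk : ∀ n : ℕ, |(k n : ℝ) - a * n| < 1) {μ : ℝ} (hμ : 0 < μ) {p : ℕ → unitInterval}
    (hp : Tendsto (fun n : ℕ => (n : ℝ) * p n) atTop (𝓝 μ)) :
    (∀ᶠ n in atTop,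
      0 < (binomialRandom (Fin n) (p n)).real {G | triangleVertexCount G = k n}) ∧
    Tendsto (fun n : ℕ => (Real.log ((binomialRandom (Fin n) (p n)).real
      {G | triangleVertexCount G = k n}) - Real.log (clusterWeight n (k n))) / n) atTop
      (𝓝 (a * Real.log μ)) := by
  have hinv : Tendsto (fun n : ℕ => (n : ℝ)⁻¹) atTop (𝓝 0) := tendsto_inv_atTop_nhds_zero_nat
  have hp0 : ∀ᶠ n in atTop, 0 < (p n : ℝ) := by
    filter_upwards [hp.eventually_const_lt hμ] with n hn
    exact pos_of_mul_pos_right hn (by positivity)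
  have hp2 : ∀ᶠ n in atTop, (p n : ℝ) ≤ 1 / 2 := by
    have h : Tendsto (fun n : ℕ => ((n : ℝ) * p n) * (n : ℝ)⁻¹) atTop (𝓝 (μ * 0)) := hp.mul hinv
    rw [mul_zero] at h
    filter_upwards [h.eventually_lt_const (show (0 : ℝ) < 1 / 2 by norm_num),
      eventually_gt_atTop 0] with n hn hn0
    have hn0 : (0 : ℝ) < n := by exact_mod_cast hn0
    rw [mul_right_comm, mul_inv_cancel₀ hn0.ne', one_mul] at hn
    exact hn.le
  have hkn := eventually_le_of_abs_sub_lt ha1 hk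
  have hk3 := eventually_three_le_of_abs_sub_lt ha0 hk
  have hka := tendsto_div_of_abs_sub_lt hk
  have hlogμ : Tendsto (fun n : ℕ => Real.log ((n : ℝ) * p n)) atTop (𝓝 (Real.log μ)) :=
    hp.log hμ.ne'
  have hlogn : Tendsto (fun n : ℕ => Real.log n * (n : ℝ)⁻¹) atTop (𝓝 0) := by
    have := (Real.isLittleO_log_id_atTop.tendsto_div_nhds_zero).comp
      (tendsto_natCast_atTop_atTop (R := ℝ))
    simpa [Function.comp_def, div_eq_mul_inv] using this
  have hpow : Tendsto (fun n : ℕ => (6 * n : ℝ) ^ (2 / 3 : ℝ) * (n : ℝ)⁻¹) atTop (𝓝 0) := by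
    have h1 : Tendsto (fun n : ℕ => (6 : ℝ) ^ (2 / 3 : ℝ) * (n : ℝ) ^ (-(1 / 3) : ℝ)) atTop
        (𝓝 ((6 : ℝ) ^ (2 / 3 : ℝ) * 0)) :=
      ((tendsto_rpow_neg_atTop (show (0 : ℝ) < 1 / 3 by norm_num)).comp
        (tendsto_natCast_atTop_atTop (R := ℝ))).const_mul _
    rw [mul_zero] at h1
    refine h1.congr' ?_
    filter_upwards [eventually_gt_atTop 0] with n hn
    have hn0 : (0 : ℝ) < n := by exact_mod_cast hn
    rw [Real.mul_rpow (by norm_num) hn0.le, mul_assoc, ← Real.rpow_neg_one (n : ℝ),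
      ← Real.rpow_add hn0]
    norm_num
  refine ⟨?_, ?_⟩
  · filter_upwards [hp0, hp2, hkn, hk3] with n h1 h2 h3 h4
    exact (le_log_triangleVertexCount (p n) h1 h2 h3 h4).1
  · have hL : Tendsto (fun n : ℕ => (k n : ℝ) / n * Real.log (n * p n) +
        5 * (Real.log (n * p n) * (n : ℝ)⁻¹ - Real.log n * (n : ℝ)⁻¹) -
        2 * (n * p n) ^ 3 * (n : ℝ)⁻¹ - 24 * (n * p n) ^ 2 * (n : ℝ)⁻¹) atTop
        (𝓝 (a * Real.log μ + 5 * (Real.log μ * 0 - 0) - 2 * μ ^ 3 * 0 - 24 * μ ^ 2 * 0)) :=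
      (((hka.mul hlogμ).add (((hlogμ.mul hinv).sub hlogn).const_mul 5)).sub
        (((hp.pow 3).const_mul 2).mul hinv)).sub (((hp.pow 2).const_mul 24).mul hinv)
    have hU : Tendsto (fun n : ℕ => (k n : ℝ) / n * Real.log (n * p n) +
        Real.log (720 * Real.exp 1) * (n : ℝ)⁻¹ + 2 * (Real.log n * (n : ℝ)⁻¹) +
        ((n * p n) ^ 2 + 7 * (n * p n)) * ((6 * n : ℝ) ^ (2 / 3 : ℝ) * (n : ℝ)⁻¹)) atTop
        (𝓝 (a * Real.log μ + Real.log (720 * Real.exp 1) * 0 + 2 * 0 +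
          (μ ^ 2 + 7 * μ) * 0)) :=
      (((hka.mul hlogμ).add (hinv.const_mul _)).add (hlogn.const_mul 2)).add
        (((hp.pow 2).add (hp.const_mul 7)).mul hpow)
    have eL : a * Real.log μ + 5 * (Real.log μ * 0 - 0) - 2 * μ ^ 3 * 0 - 24 * μ ^ 2 * 0 =
      a * Real.log μ := by ring
    have eU : a * Real.log μ + Real.log (720 * Real.exp 1) * 0 + 2 * 0 + (μ ^ 2 + 7 * μ) * 0 =
      a * Real.log μ := by ring
    rw [eL] at hL
    rw [eU] at hU
    refine tendsto_of_tendsto_of_tendsto_of_le_of_le' hL hU ?_ ?_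
    · filter_upwards [hp0, hp2, hkn, hk3] with n h1 h2 h3 h4
      have h := (le_log_triangleVertexCount (p n) h1 h2 h3 h4).2
      rw [div_eq_mul_inv _ (n : ℝ)]
      refine le_trans (le_of_eq ?_) (mul_le_mul_of_nonneg_right h (by positivity))
      ring
    · filter_upwards [hp0, hp2, hkn, hk3] with n h1 h2 h3 h4
      have h := log_triangleVertexCount_le (p n) h1 h3 (by omega)
        (le_log_triangleVertexCount (p n) h1 h2 h3 h4).1
      rw [div_eq_mul_inv _ (n : ℝ)]
      refine le_trans (mul_le_mul_of_nonneg_right h (by positivity)) (le_of_eq ?_)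
      ring

end SimpleGraph

/-! ### The rate function as a Legendre transform -/

/-- The limiting cumulant generating function `(lam / 2) (e ^ t - 1) + a t`, that of `a` plus a
Poisson variable of mean `lam / 2`. -/
noncomputable def edgeCgf (lam a t : ℝ) : ℝ := lam / 2 * (Real.exp t - 1) + a * t

theorem edgeRate_of_le {lam a x : ℝ} (h : a ≤ x) : edgeRate lam a x =
    (((x - a) * Real.log ((x - a) / (lam / 2)) - (x - a) + lam / 2 : ℝ) : EReal) := by
  rw [edgeRate, if_neg (not_lt.2 h)]

theorem edgeRate_of_lt {lam a x : ℝ} (h : x < a) : edgeRate lam a x = ⊤ := by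
  rw [edgeRate, if_pos h]

theorem mul_sub_edgeCgf_le_edgeRate {lam : ℝ} (hlam : 0 < lam) (a t x : ℝ) :
    ((t * x - edgeCgf lam a t : ℝ) : EReal) ≤ edgeRate lam a x := by
  rcases lt_or_ge x a with h | h
  · rw [edgeRate_of_lt h]; exact le_top
  · rw [edgeRate_of_le h, EReal.coe_le_coe_iff, edgeCgf]
    obtain ⟨y, rfl⟩ : ∃ y, x = a + y := ⟨x - a, by ring⟩
    rw [add_sub_cancel_left]
    have hy : 0 ≤ y := by linarith
    set b := lam / 2 with hb
    have hb0 : 0 < b := by positivity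
    have he := Real.exp_pos t
    rcases hy.eq_or_lt with rfl | hy
    · simp
      nlinarith
    · have h1 := Real.log_le_sub_one_of_pos (show 0 < Real.exp t / (y / b) by positivity)
      rw [Real.log_div he.ne' (by positivity), Real.log_exp] at h1
      have h2 := mul_le_mul_of_nonneg_left h1 hy.le
      have h3 : y * (Real.exp t / (y / b) - 1) = b * Real.exp t - y := by field_simp
      rw [h3] at h2
      linarith

/-- Together with `mul_sub_edgeCgf_le_edgeRate`, this says that `edgeRate` is the Legendre transform
of `edgeCgf`. For `x ≤ a` the supremum over `t` is approached only as `t → -∞`. -/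
theorem exists_lt_mul_sub_edgeCgf {lam : ℝ} (hlam : 0 < lam) {a x c : ℝ}
    (h : (c : EReal) < edgeRate lam a x) : ∃ t, c < t * x - edgeCgf lam a t := by
  have e : ∀ t, t * x - edgeCgf lam a t = t * (x - a) + lam / 2 * (1 - Real.exp t) := fun t => by
    rw [edgeCgf]; ring
  simp_rw [e]
  set b := lam / 2 with hb
  have hb0 : 0 < b := by positivity
  rcases lt_trichotomy x a with hx | rfl | hx
  · refine ⟨-((|c| + 1) / (a - x)), ?_⟩
    have h1 : 0 < a - x := by linarith
    have h2 : -((|c| + 1) / (a - x)) * (x - a) = |c| + 1 := by field_simp; ring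
    have h3 : Real.exp (-((|c| + 1) / (a - x))) ≤ 1 := by
      rw [Real.exp_le_one_iff, neg_nonpos]; positivity
    have h4 := le_abs_self c
    have h5 : 0 ≤ b * (1 - Real.exp (-((|c| + 1) / (a - x)))) :=
      mul_nonneg hb0.le (by linarith)
    linarith
  · rw [edgeRate_of_le le_rfl, EReal.coe_lt_coe_iff] at h
    simp only [sub_self, zero_mul, zero_add, mul_zero, ← hb] at h ⊢
    refine ⟨Real.log ((b - c) / (2 * b)), ?_⟩
    have h1 : 0 < b - c := by linarith
    rw [Real.exp_log (by positivity)]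
    have h2 : b * (1 - (b - c) / (2 * b)) = b - (b - c) / 2 := by field_simp
    linarith
  · rw [edgeRate_of_le hx.le, EReal.coe_lt_coe_iff, ← hb] at h
    have h1 : 0 < x - a := by linarith
    refine ⟨Real.log ((x - a) / b), ?_⟩
    rw [Real.exp_log (by positivity)]
    have h2 : b * (1 - (x - a) / b) = b - (x - a) := by field_simp
    linarith

theorem edgeRate_nonneg {lam : ℝ} (hlam : 0 < lam) (a x : ℝ) : 0 ≤ edgeRate lam a x := by
  have := mul_sub_edgeCgf_le_edgeRate hlam a 0 x
  simpa [edgeCgf] using this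

theorem lowerSemicontinuous_edgeRate {lam : ℝ} (hlam : 0 < lam) (a : ℝ) :
    LowerSemicontinuous (edgeRate lam a) := by
  intro x y hy
  obtain ⟨c, hc1, hc2⟩ := EReal.lt_iff_exists_real_btwn.1 hy
  obtain ⟨t, ht⟩ := exists_lt_mul_sub_edgeCgf hlam hc2
  have hcont : Continuous fun x => t * x - edgeCgf lam a t := by fun_prop
  filter_upwards [hcont.continuousAt.eventually_const_lt ht] with x' hx'
  exact hc1.trans_le ((EReal.coe_le_coe_iff.2 hx'.le).trans (mul_sub_edgeCgf_le_edgeRate hlam a t x'))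

theorem isCompact_edgeRate_le {lam : ℝ} (hlam : 0 < lam) (a c : ℝ) :
    IsCompact {x | edgeRate lam a x ≤ (c : EReal)} := by
  refine IsCompact.of_isClosed_subset (isCompact_Icc (a := a) (b := c + edgeCgf lam a 1))
    ((lowerSemicontinuous_edgeRate hlam a).isClosed_preimage (c : EReal)) fun x hx => ?_
  simp only [Set.mem_ofPred_eq] at hx
  refine ⟨?_, ?_⟩
  · by_contra h
    rw [edgeRate_of_lt (not_le.1 h)] at hx
    exact absurd hx (not_le.2 (EReal.coe_lt_top c))
  · have := (mul_sub_edgeCgf_le_edgeRate hlam a 1 x).trans hx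
    rw [EReal.coe_le_coe_iff] at this
    linarith

/-! ### Large deviations from convergence of the cumulant generating functions -/

section GaertnerEllis

variable {Ω : ℕ → Type*} [∀ n, MeasurableSpace (Ω n)] [∀ n, Finite (Ω n)]
  [∀ n, MeasurableSingletonClass (Ω n)] {P : ∀ n, Measure (Ω n)} {X : ∀ n, Ω n → ℝ} {Λ : ℝ → ℝ}

theorem eventually_mgf_bounds (hP : ∀ᶠ n in atTop, IsProbabilityMeasure (P n))
    {t : ℝ} (hM : Tendsto (fun n : ℕ => Real.log (mgf (X n) (P n) t) / n) atTop (𝓝 (Λ t)))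
    {ε : ℝ} (hε : 0 < ε) : ∀ᶠ n : ℕ in atTop, Real.exp (n * (Λ t - ε)) ≤ mgf (X n) (P n) t ∧
      mgf (X n) (P n) t ≤ Real.exp (n * (Λ t + ε)) := by
  filter_upwards [hP, hM.eventually_const_lt (show Λ t - ε < Λ t by linarith),
    hM.eventually_lt_const (show Λ t < Λ t + ε by linarith), eventually_gt_atTop 0]
    with n h1 h2 h3 hn
  have hn0 : (0 : ℝ) < n := by exact_mod_cast hn
  have hpos : 0 < mgf (X n) (P n) t := mgf_pos Integrable.of_finite
  rw [lt_div_iff₀ hn0] at h2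
  rw [div_lt_iff₀ hn0] at h3
  rw [← Real.le_log_iff_exp_le hpos, ← Real.log_le_iff_le_exp hpos]
  exact ⟨by linarith, by linarith⟩

theorem eventually_half_mul_exp (c : ℝ) {d : ℝ} (h : c < d) :
    ∀ᶠ n : ℕ in atTop, Real.exp (-(n * d)) ≤ 1 / 2 * Real.exp (-(n * c)) := by
  filter_upwards [(tendsto_natCast_atTop_atTop (R := ℝ)).eventually_ge_atTop
    (Real.log 2 / (d - c))] with n hn
  rw [div_le_iff₀ (by linarith)] at hn
  rw [show (1 / 2 : ℝ) = Real.exp (-Real.log 2) by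
    rw [Real.exp_neg, Real.exp_log (by norm_num)]; norm_num, ← Real.exp_add]
  exact Real.exp_le_exp.2 (by linarith)

theorem eventually_upper_tail_le (hP : ∀ᶠ n in atTop, IsProbabilityMeasure (P n))
    {t : ℝ} (hM : Tendsto (fun n : ℕ => Real.log (mgf (X n) (P n) t) / n) atTop (𝓝 (Λ t)))
    {c x : ℝ} (ht : 0 ≤ t) (h : c < t * x - Λ t) :
    ∀ᶠ n : ℕ in atTop, (P n).real {ω | x ≤ X n ω / n} ≤ 1 / 2 * Real.exp (-(n * c)) := by
  obtain ⟨d, hcd, hd⟩ := exists_between h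
  filter_upwards [hP, eventually_mgf_bounds hP hM (ε := t * x - Λ t - d) (by linarith),
    eventually_half_mul_exp c hcd, eventually_gt_atTop 0] with n h1 h2 h3 hn
  have hn0 : (0 : ℝ) < n := by exact_mod_cast hn
  refine le_trans ?_ h3
  have h4 := measure_ge_le_exp_mul_mgf (μ := P n) (X := X n) (x * n) ht Integrable.of_finite
  simp_rw [le_div_iff₀ hn0]
  refine h4.trans ((mul_le_mul_of_nonneg_left h2.2 (Real.exp_pos _).le).trans ?_)
  rw [← Real.exp_add]
  exact Real.exp_le_exp.2 (by ring_nf; rfl)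

theorem eventually_lower_tail_le (hP : ∀ᶠ n in atTop, IsProbabilityMeasure (P n))
    {t : ℝ} (hM : Tendsto (fun n : ℕ => Real.log (mgf (X n) (P n) t) / n) atTop (𝓝 (Λ t)))
    {c x : ℝ} (ht : t ≤ 0) (h : c < t * x - Λ t) :
    ∀ᶠ n : ℕ in atTop, (P n).real {ω | X n ω / n ≤ x} ≤ 1 / 2 * Real.exp (-(n * c)) := by
  obtain ⟨d, hcd, hd⟩ := exists_between h
  filter_upwards [hP, eventually_mgf_bounds hP hM (ε := t * x - Λ t - d) (by linarith),
    eventually_half_mul_exp c hcd, eventually_gt_atTop 0] with n h1 h2 h3 hn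
  have hn0 : (0 : ℝ) < n := by exact_mod_cast hn
  refine le_trans ?_ h3
  have h4 := measure_le_le_exp_mul_mgf (μ := P n) (X := X n) (x * n) ht Integrable.of_finite
  simp_rw [div_le_iff₀ hn0]
  refine h4.trans ((mul_le_mul_of_nonneg_left h2.2 (Real.exp_pos _).le).trans ?_)
  rw [← Real.exp_add]
  exact Real.exp_le_exp.2 (by ring_nf; rfl)

/-- A tilting argument without a change of measure: the three moment generating functions at `t` and
`t ± s` show that the tilted law with parameter `t` charges the `δ`-neighbourhood of `x`. -/
theorem mgf_le_ball {n : ℕ} (hn : 0 < n) [IsProbabilityMeasure (P n)] (t s x δ : ℝ) (hs : 0 ≤ s) :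
    mgf (X n) (P n) t ≤
      Real.exp (n * (t * x + |t| * δ)) * (P n).real {ω | |X n ω / n - x| < δ} +
      Real.exp (-(n * (s * (x + δ)))) * mgf (X n) (P n) (t + s) +
      Real.exp (n * (s * (x - δ))) * mgf (X n) (P n) (t - s) := by
  have hn0 : (0 : ℝ) < n := by exact_mod_cast hn
  set B : Set (Ω n) := {ω | |X n ω / n - x| < δ} with hB
  have hBm : MeasurableSet B := (Set.toFinite _).measurableSet
  have hpt : ∀ ω, Real.exp (t * X n ω) ≤
      B.indicator (fun _ => Real.exp (n * (t * x + |t| * δ))) ω +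
      Real.exp (-(n * (s * (x + δ)))) * Real.exp ((t + s) * X n ω) +
      Real.exp (n * (s * (x - δ))) * Real.exp ((t - s) * X n ω) := by
    intro ω
    rw [← Real.exp_add, ← Real.exp_add]
    set y := X n ω / n with hy
    have hX : X n ω = n * y := by rw [hy]; field_simp
    rw [hX]
    have e2 := Real.exp_pos (-(n * (s * (x + δ))) + (t + s) * (n * y))
    have e3 := Real.exp_pos (n * (s * (x - δ)) + (t - s) * (n * y))
    by_cases h : |y - x| < δ
    · have hω : ω ∈ B := by simpa only [hB, Set.mem_ofPred_eq] using h
      rw [Set.indicator_of_mem hω]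
      have h1 : t * (y - x) ≤ |t| * δ :=
        (le_abs_self _).trans (by rw [abs_mul]; gcongr)
      have : Real.exp (t * (n * y)) ≤ Real.exp (n * (t * x + |t| * δ)) := by
        refine Real.exp_le_exp.2 ?_
        have := mul_le_mul_of_nonneg_left h1 hn0.le
        linarith
      linarith
    · have hω : ω ∉ B := by simpa only [hB, Set.mem_ofPred_eq] using h
      rw [Set.indicator_of_notMem hω]
      rw [not_lt, le_abs] at h
      rcases h with h | h
      · have : Real.exp (t * (n * y)) ≤
            Real.exp (-(n * (s * (x + δ))) + (t + s) * (n * y)) := by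
          refine Real.exp_le_exp.2 ?_
          have : 0 ≤ n * (s * (y - x - δ)) := mul_nonneg hn0.le (mul_nonneg hs (by linarith))
          linarith
        linarith
      · have : Real.exp (t * (n * y)) ≤
            Real.exp (n * (s * (x - δ)) + (t - s) * (n * y)) := by
          refine Real.exp_le_exp.2 ?_
          have : 0 ≤ n * (s * (-(y - x) - δ)) := mul_nonneg hn0.le (mul_nonneg hs (by linarith))
          linarith
        linarith
  have h := integral_mono (μ := P n) Integrable.of_finite Integrable.of_finite hpt
  rw [integral_add Integrable.of_finite Integrable.of_finite,
    integral_add Integrable.of_finite Integrable.of_finite, integral_const_mul,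
    integral_const_mul, integral_indicator_const _ hBm, smul_eq_mul, mul_comm ((P n).real B)] at h
  exact h

/-- The exponential lower bound for a `δ`-neighbourhood of `x = Λ' t`. Since `Λ` is differentiable
at `t`, the two error terms of `mgf_le_ball` are exponentially smaller than the main term for small
`s`. -/
theorem eventually_le_ball (hP : ∀ᶠ n in atTop, IsProbabilityMeasure (P n))
    (hM : ∀ t, Tendsto (fun n : ℕ => Real.log (mgf (X n) (P n) t) / n) atTop (𝓝 (Λ t)))
    {t x : ℝ} (hΛ : HasDerivAt Λ x t) {δ ε : ℝ} (hδ : 0 < δ) (hε : 0 < ε) :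
    ∀ᶠ n : ℕ in atTop, Real.exp (-(n * (t * x - Λ t + |t| * δ + ε))) ≤
      (P n).real {ω | |X n ω / n - x| < δ} := by
  obtain ⟨s, hs, hs1, hs2⟩ : ∃ s > 0, Λ (t + s) - Λ t - s * x ≤ δ / 2 * s ∧
      Λ (t - s) - Λ t + s * x ≤ δ / 2 * s := by
    have h := (hasDerivAt_iff_isLittleO_nhds_zero.1 hΛ).bound (show 0 < δ / 2 by positivity)
    obtain ⟨r, hr, hr'⟩ := Metric.eventually_nhds_iff.1 h
    refine ⟨r / 2, by positivity, ?_, ?_⟩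
    · have := hr' (y := r / 2) (by rw [dist_zero_right, Real.norm_eq_abs, abs_of_pos] <;> linarith)
      rw [Real.norm_eq_abs, Real.norm_eq_abs, abs_of_pos (by positivity : 0 < r / 2),
        smul_eq_mul] at this
      exact (le_abs_self _).trans this
    · have := hr' (y := -(r / 2))
        (by rw [dist_zero_right, norm_neg, Real.norm_eq_abs, abs_of_pos] <;> linarith)
      rw [Real.norm_eq_abs, norm_neg, Real.norm_eq_abs, abs_of_pos (by positivity : 0 < r / 2),
        smul_eq_mul] at this
      refine le_trans (le_trans (le_of_eq ?_) (le_abs_self _)) this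
      rw [← sub_eq_add_neg]; ring
  set η := min (δ * s / 16) (ε / 4) with hη
  have hη0 : 0 < η := lt_min (by positivity) (by positivity)
  have hη1 : η ≤ δ * s / 16 := min_le_left _ _
  have hη2 : η ≤ ε / 4 := min_le_right _ _
  have hgap : -(Λ t - η) < δ * s / 4 - (Λ t + η) := by
    have : 0 < δ * s := by positivity
    linarith
  filter_upwards [hP, eventually_mgf_bounds hP (hM t) hη0,
    eventually_mgf_bounds hP (hM (t + s)) hη0, eventually_mgf_bounds hP (hM (t - s)) hη0,
    eventually_half_mul_exp _ hgap, eventually_half_mul_exp 0 hη0, eventually_half_mul_exp 0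
      (show 0 < ε / 4 by positivity),
    eventually_gt_atTop 0] with n h1 h2 h3 h4 h5 h6 h7 hn
  have hn0 : (0 : ℝ) < n := by exact_mod_cast hn
  have h := mgf_le_ball (P := P) (X := X) hn t s x δ hs.le
  set Z := (P n).real {ω | |X n ω / n - x| < δ}
  set E := Real.exp (n * (Λ t - η)) with hE
  have hE0 : 0 < E := Real.exp_pos _
  have hmid : Real.exp (-(n * (δ * s / 4 - (Λ t + η)))) ≤ 1 / 2 * E := by
    rw [hE, show n * (Λ t - η) = -(n * -(Λ t - η)) by ring]
    exact h5
  have hq : ∀ u : ℝ, u ≤ Λ t - δ * s / 2 + η → Real.exp (n * u) ≤ 1 / 4 * E := by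
    intro u hu
    have e : Real.exp (n * u) ≤
        Real.exp (-(n * (δ * s / 4 - (Λ t + η)))) * Real.exp (-(n * η)) := by
      rw [← Real.exp_add]
      refine Real.exp_le_exp.2 ?_
      have : 0 ≤ n * (Λ t - δ * s / 4 - u) := by
        refine mul_nonneg hn0.le ?_
        have : 0 < δ * s := by positivity
        linarith
      linarith
    refine e.trans ?_
    rw [mul_zero, neg_zero, Real.exp_zero, mul_one] at h6
    calc _ ≤ (1 / 2 * E) * (1 / 2) := by gcongr
      _ = _ := by ring
  have t1 : Real.exp (-(n * (s * (x + δ)))) * mgf (X n) (P n) (t + s) ≤ 1 / 4 * E := by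
    refine (mul_le_mul_of_nonneg_left h3.2 (Real.exp_pos _).le).trans ?_
    rw [← Real.exp_add, ← mul_neg, ← mul_add]
    exact hq _ (by linarith)
  have t2 : Real.exp (n * (s * (x - δ))) * mgf (X n) (P n) (t - s) ≤ 1 / 4 * E := by
    refine (mul_le_mul_of_nonneg_left h4.2 (Real.exp_pos _).le).trans ?_
    rw [← Real.exp_add, ← mul_add]
    exact hq _ (by linarith)
  have hmain : 1 / 2 * E ≤ Real.exp (n * (t * x + |t| * δ)) * Z := by linarith [h2.1]
  rw [mul_zero, neg_zero, Real.exp_zero, mul_one] at h7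
  have h8 : Real.exp (-(n * (ε / 4))) * E ≤ Real.exp (n * (t * x + |t| * δ)) * Z :=
    (mul_le_mul_of_nonneg_right h7 hE0.le).trans hmain
  rw [← div_le_iff₀' (Real.exp_pos _), hE, ← Real.exp_add, ← Real.exp_sub] at h8
  refine le_trans (Real.exp_le_exp.2 ?_) h8
  have : 0 ≤ n * (ε - ε / 4 - η) := mul_nonneg hn0.le (by linarith)
  linarith

end GaertnerEllis

section EdgeLDP

variable {Ω : ℕ → Type*} [∀ n, MeasurableSpace (Ω n)] [∀ n, Finite (Ω n)]
  [∀ n, MeasurableSingletonClass (Ω n)] {P : ∀ n, Measure (Ω n)} {X : ∀ n, Ω n → ℝ}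

/-- The upper bound of the large deviation principle. The rate function decreases to the left of its
zero `a + lam / 2` and increases to the right of it, so that only the points of `F` next to this
zero on either side matter. -/
theorem eventually_real_preimage_le {lam : ℝ} (hlam : 0 < lam) {a : ℝ}
    (hP : ∀ᶠ n in atTop, IsProbabilityMeasure (P n))
    (hM : ∀ t, Tendsto (fun n : ℕ => Real.log (mgf (X n) (P n) t) / n) atTop
      (𝓝 (edgeCgf lam a t)))
    {F : Set ℝ} (hF : IsClosed F) {c : ℝ} (hc : (c : EReal) < ⨅ x ∈ F, edgeRate lam a x) :
    ∀ᶠ n : ℕ in atTop,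
      (P n).real ((fun ω => X n ω / n) ⁻¹' F) ≤ Real.exp (-(n * c)) := by
  have hcF : ∀ x ∈ F, (c : EReal) < edgeRate lam a x := fun x hx =>
    hc.trans_le (iInf₂_le x hx)
  rcases lt_or_ge c 0 with hc0 | hc0
  · filter_upwards [hP] with n h1
    refine measureReal_le_one.trans (Real.one_le_exp ?_)
    have : 0 ≤ n * (-c) := mul_nonneg (by positivity) (by linarith)
    linarith
  set x₀ := a + lam / 2 with hx₀
  have hrate₀ : ∀ t, t * x₀ - edgeCgf lam a t ≤ 0 := by
    intro t
    have h := mul_sub_edgeCgf_le_edgeRate hlam a t x₀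
    rw [edgeRate_of_le (by rw [hx₀]; linarith), EReal.coe_le_coe_iff, hx₀, add_sub_cancel_left,
      div_self (by positivity), Real.log_one] at h
    rw [hx₀]
    linarith
  have hleft : ∀ᶠ n : ℕ in atTop, (P n).real ((fun ω => X n ω / n) ⁻¹' (F ∩ Set.Iic x₀)) ≤
      1 / 2 * Real.exp (-(n * c)) := by
    rcases (F ∩ Set.Iic x₀).eq_empty_or_nonempty with he | hne
    · filter_upwards with n
      rw [he, Set.preimage_empty, measureReal_empty]
      positivity
    · have hbdd : BddAbove (F ∩ Set.Iic x₀) := ⟨x₀, fun x hx => hx.2⟩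
      have hmem := (hF.inter isClosed_Iic).csSup_mem hne hbdd
      set x₁ := sSup (F ∩ Set.Iic x₀)
      obtain ⟨t, ht⟩ := exists_lt_mul_sub_edgeCgf hlam (hcF x₁ hmem.1)
      have ht0 : t ≤ 0 := by
        by_contra h
        have := mul_le_mul_of_nonneg_left (Set.mem_Iic.1 hmem.2) (le_of_not_ge h)
        linarith [hrate₀ t]
      filter_upwards [hP, eventually_lower_tail_le hP (hM t) ht0 ht] with n h1 h2
      refine (measureReal_mono ?_).trans h2
      intro ω hω
      rw [Set.mem_preimage] at hω
      simp only [Set.mem_ofPred_eq]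
      exact le_csSup hbdd hω
  have hright : ∀ᶠ n : ℕ in atTop, (P n).real ((fun ω => X n ω / n) ⁻¹' (F ∩ Set.Ici x₀)) ≤
      1 / 2 * Real.exp (-(n * c)) := by
    rcases (F ∩ Set.Ici x₀).eq_empty_or_nonempty with he | hne
    · filter_upwards with n
      rw [he, Set.preimage_empty, measureReal_empty]
      positivity
    · have hbdd : BddBelow (F ∩ Set.Ici x₀) := ⟨x₀, fun x hx => hx.2⟩
      have hmem := (hF.inter isClosed_Ici).csInf_mem hne hbdd
      set x₂ := sInf (F ∩ Set.Ici x₀)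
      obtain ⟨t, ht⟩ := exists_lt_mul_sub_edgeCgf hlam (hcF x₂ hmem.1)
      have ht0 : 0 ≤ t := by
        by_contra h
        have := mul_le_mul_of_nonpos_left (Set.mem_Ici.1 hmem.2) (le_of_not_ge h)
        linarith [hrate₀ t]
      filter_upwards [hP, eventually_upper_tail_le hP (hM t) ht0 ht] with n h1 h2
      refine (measureReal_mono ?_).trans h2
      intro ω hω
      rw [Set.mem_preimage] at hω
      simp only [Set.mem_ofPred_eq]
      exact csInf_le hbdd hω
  filter_upwards [hP, hleft, hright] with n h1 h2 h3
  have hsub : (fun ω => X n ω / n) ⁻¹' F ⊆ ((fun ω => X n ω / n) ⁻¹' (F ∩ Set.Iic x₀)) ∪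
      ((fun ω => X n ω / n) ⁻¹' (F ∩ Set.Ici x₀)) := by
    intro ω hω
    rcases le_total (X n ω / n) x₀ with h | h
    · exact Or.inl ⟨hω, h⟩
    · exact Or.inr ⟨hω, h⟩
  refine (measureReal_mono hsub).trans ((measureReal_union_le _ _).trans ?_)
  linarith

theorem hasDerivAt_edgeCgf (lam a t : ℝ) :
    HasDerivAt (edgeCgf lam a) (lam / 2 * Real.exp t + a) t := by
  have h := ((((Real.hasDerivAt_exp t).sub_const 1).const_mul (lam / 2)).add
    ((hasDerivAt_id t).const_mul a))
  refine h.congr_deriv ?_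
  ring

theorem eventually_le_real_preimage {lam : ℝ} (hlam : 0 < lam) {a : ℝ}
    (hP : ∀ᶠ n in atTop, IsProbabilityMeasure (P n))
    (hM : ∀ t, Tendsto (fun n : ℕ => Real.log (mgf (X n) (P n) t) / n) atTop
      (𝓝 (edgeCgf lam a t)))
    {U : Set ℝ} (hU : IsOpen U) {x : ℝ} (hx : x ∈ U) {r : ℝ} (hr : edgeRate lam a x < r) :
    ∀ᶠ n : ℕ in atTop,
      Real.exp (-(n * r)) ≤ (P n).real ((fun ω => X n ω / n) ⁻¹' U) := by
  have main : ∀ x ∈ U, a < x → edgeRate lam a x < r → ∀ᶠ n : ℕ in atTop,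
      Real.exp (-(n * r)) ≤ (P n).real ((fun ω => X n ω / n) ⁻¹' U) := by
    intro x hx hax hr
    obtain ⟨δ₀, hδ₀, hball⟩ := Metric.isOpen_iff.1 hU x hx
    set b := lam / 2 with hb
    have hb0 : 0 < b := by positivity
    have hxa : 0 < x - a := by linarith
    set t := Real.log ((x - a) / b) with ht
    have hexp : b * Real.exp t = x - a := by
      rw [ht, Real.exp_log (by positivity)]; field_simp
    rw [edgeRate_of_le hax.le, EReal.coe_lt_coe_iff, ← hb, ← ht] at hr
    have hI : t * x - edgeCgf lam a t < r := by
      rw [edgeCgf, ← hb]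
      linarith
    set ε := r - (t * x - edgeCgf lam a t) with hε
    have hε0 : 0 < ε := by linarith
    have hderiv : HasDerivAt (edgeCgf lam a) x t :=
      (hasDerivAt_edgeCgf lam a t).congr_deriv (by rw [← hb, hexp]; ring)
    set δ := min δ₀ (ε / (2 * (|t| + 1))) with hδ
    have hδ0 : 0 < δ := lt_min hδ₀ (by positivity)
    have htδ : |t| * δ ≤ ε / 2 := by
      have h1 : δ ≤ ε / (2 * (|t| + 1)) := min_le_right _ _
      rw [le_div_iff₀ (by positivity)] at h1
      linarith
    filter_upwards [hP, eventually_le_ball hP hM hderiv hδ0 (half_pos hε0)] with n h1 h2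
    refine le_trans (Real.exp_le_exp.2 ?_) (h2.trans (measureReal_mono ?_))
    · refine neg_le_neg (mul_le_mul_of_nonneg_left ?_ (by positivity))
      linarith
    · intro ω hω
      simp only [Set.mem_ofPred_eq] at hω
      exact hball (lt_of_lt_of_le hω (min_le_left _ _))
  rcases lt_trichotomy x a with hxa | rfl | hxa
  · rw [edgeRate_of_lt hxa] at hr
    exact absurd hr not_top_lt
  · -- the rate does not exceed its value at `x = a` in the points of `U` slightly to the right
    obtain ⟨δ₀, hδ₀, hball⟩ := Metric.isOpen_iff.1 hU x hx
    set b := lam / 2 with hb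
    have hb0 : 0 < b := by positivity
    set y := min (δ₀ / 2) b with hy
    have hy0 : 0 < y := lt_min (by positivity) hb0
    refine main (x + y) (hball ?_) (by linarith) (lt_of_le_of_lt ?_ hr)
    · rw [Metric.mem_ball, Real.dist_eq, add_sub_cancel_left, abs_of_pos hy0]
      exact (min_le_left _ _).trans_lt (by linarith)
    · rw [edgeRate_of_le le_rfl, edgeRate_of_le (by linarith), EReal.coe_le_coe_iff,
        add_sub_cancel_left, ← hb]
      have h1 : Real.log (y / b) ≤ 0 :=
        Real.log_nonpos (by positivity) ((div_le_one hb0).2 (min_le_right _ _))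
      have h2 := mul_nonpos_of_nonneg_of_nonpos hy0.le h1
      simp
      linarith
  · exact main x hx hxa hr

/-- The large deviation principle with rate function `edgeRate` follows from convergence of the
cumulant generating functions (Gärtner–Ellis). -/
theorem satisfiesGoodLDP_of_tendsto_mgf {lam : ℝ} (hlam : 0 < lam) {a : ℝ}
    (hP : ∀ᶠ n in atTop, IsProbabilityMeasure (P n))
    (hM : ∀ t, Tendsto (fun n : ℕ => Real.log (mgf (X n) (P n) t) / n) atTop
      (𝓝 (edgeCgf lam a t))) :
    SatisfiesGoodLDP P (fun n ω => X n ω / (n : ℝ)) (fun n : ℕ => (n : ℝ)) (edgeRate lam a) where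
  speed_tendsto := tendsto_natCast_atTop_atTop
  eventually_prob := hP
  rate_nonneg := edgeRate_nonneg hlam a
  rate_lsc := lowerSemicontinuous_edgeRate hlam a
  rate_good := isCompact_edgeRate_le hlam a
  upper_bound F hF := by
    rw [EReal.le_neg]
    refine EReal.ge_of_forall_gt_iff_ge.1 fun c hc => ?_
    rw [EReal.le_neg]
    refine limsup_le_of_le (by isBoundedDefault) ?_
    filter_upwards [hP, eventually_real_preimage_le hlam hP hM hF hc, eventually_gt_atTop 0]
      with n h1 h2 hn
    have hn0 : (0 : ℝ) < n := by exact_mod_cast hn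
    have h3 : P n ((fun ω => X n ω / n) ⁻¹' F) ≤ ENNReal.ofReal (Real.exp (-(n * c))) := by
      rw [measureReal_def] at h2
      exact (ENNReal.le_ofReal_iff_toReal_le (measure_ne_top _ _) (Real.exp_pos _).le).2 h2
    have h4 := ENNReal.log_le_log h3
    rw [ENNReal.log_ofReal, if_neg (not_le.2 (Real.exp_pos _)), Real.log_exp] at h4
    refine (mul_le_mul_of_nonneg_left h4
      (EReal.coe_nonneg.2 (by positivity : (0 : ℝ) ≤ (n : ℝ)⁻¹))).trans_eq ?_
    rw [← EReal.coe_mul, ← EReal.coe_neg]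
    congr 1
    field_simp
  lower_bound U hU := by
    rw [EReal.neg_le]
    refine le_iInf₂ fun x hx => ?_
    refine EReal.le_of_forall_lt_iff_le.1 fun r hr => ?_
    rw [EReal.neg_le]
    refine le_liminf_of_le (by isBoundedDefault) ?_
    filter_upwards [hP, eventually_le_real_preimage hlam hP hM hU hx hr, eventually_gt_atTop 0]
      with n h1 h2 hn
    have hn0 : (0 : ℝ) < n := by exact_mod_cast hn
    have h3 : ENNReal.ofReal (Real.exp (-(n * r))) ≤ P n ((fun ω => X n ω / n) ⁻¹' U) := by
      rw [measureReal_def] at h2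
      exact (ENNReal.ofReal_le_iff_le_toReal (measure_ne_top _ _)).2 h2
    have h4 := ENNReal.log_le_log h3
    rw [ENNReal.log_ofReal, if_neg (not_le.2 (Real.exp_pos _)), Real.log_exp] at h4
    refine le_trans (le_of_eq ?_) (mul_le_mul_of_nonneg_left h4
      (EReal.coe_nonneg.2 (by positivity : (0 : ℝ) ≤ (n : ℝ)⁻¹)))
    rw [← EReal.coe_mul, ← EReal.coe_neg]
    congr 1
    field_simp

end EdgeLDP

/-! ### Exponential tilting by the number of edges -/

namespace SimpleGraph

/-- The edge probability after exponential tilting by the number of edges: the odds `p / (1 - p)`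
are multiplied by `e ^ t`. -/
noncomputable def tiltProb (p : unitInterval) (t : ℝ) : unitInterval :=
  ⟨p * Real.exp t / (1 - p + p * Real.exp t), by
    have h0 := p.2.1
    have h1 : 0 ≤ 1 - (p : ℝ) := sub_nonneg.2 p.2.2
    have he := Real.exp_pos t
    exact ⟨by positivity, div_le_one_of_le₀ (by linarith) (by positivity)⟩⟩

theorem graphWeight_mul_exp {V : Type*} [Finite V] (p : unitInterval) (t : ℝ)
    (hc : 0 < 1 - (p : ℝ) + p * Real.exp t) (G : SimpleGraph V) :
    graphWeight (p : ℝ) G * Real.exp (t * edgeCount G) =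
      (1 - (p : ℝ) + p * Real.exp t) ^ (Nat.card V).choose 2 *
        graphWeight (tiltProb p t : ℝ) G := by
  obtain ⟨d, hd⟩ := Nat.exists_eq_add_of_le (edgeCount_le_choose G)
  have h1 : 1 - (tiltProb p t : ℝ) = (1 - p) / (1 - (p : ℝ) + p * Real.exp t) := by
    rw [tiltProb]; field_simp; ring
  unfold graphWeight
  rw [h1, tiltProb, hd, Nat.add_sub_cancel_left, div_pow, div_pow, mul_pow, pow_add,
    mul_comm t, Real.exp_nat_mul]
  field_simp

/-- The moment generating function of the number of edges, conditionally on an event `A`, is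
determined by the probabilities of `A` under the original and under the tilted edge
probability. -/
theorem mgf_edgeCount_cond {V : Type*} [Finite V] (p : unitInterval) (t : ℝ)
    (hc : 0 < 1 - (p : ℝ) + p * Real.exp t) (A : Set (SimpleGraph V)) :
    mgf (fun G => (edgeCount G : ℝ)) (cond (binomialRandom V p) A) t =
      (1 - (p : ℝ) + p * Real.exp t) ^ (Nat.card V).choose 2 *
        (binomialRandom V (tiltProb p t)).real A / (binomialRandom V p).real A := by
  classical
  cases nonempty_fintype V
  rw [mgf, integral_fintype Integrable.of_finite, binomialRandom_real_eq_sum (tiltProb p t),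
    Finset.mul_sum, Finset.sum_div]
  refine Finset.sum_congr rfl fun G _ => ?_
  rw [measureReal_def, cond_apply (Set.toFinite A).measurableSet, ENNReal.toReal_mul,
    ENNReal.toReal_inv, ← measureReal_def, ← measureReal_def, smul_eq_mul]
  by_cases hG : G ∈ A
  · rw [Set.inter_eq_right.2 (Set.singleton_subset_iff.2 hG), binomialRandom_real_singleton,
      if_pos hG, ← graphWeight_mul_exp p t hc]
    ring
  · rw [Set.inter_singleton_eq_empty.2 hG, measureReal_empty, if_neg hG]
    simp

theorem coe_sparseEdgeProb {lam : ℝ} (hlam : 0 < lam) {n : ℕ} (hn : lam ≤ n) :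
    (sparseEdgeProb lam n : ℝ) = lam / n := by
  have h : lam / n ∈ Set.Icc (0 : ℝ) 1 := ⟨by positivity, div_le_one_of_le₀ hn (by positivity)⟩
  rw [sparseEdgeProb, Set.projIcc_of_mem _ h]

theorem tendsto_mul_sparseEdgeProb {lam : ℝ} (hlam : 0 < lam) :
    Tendsto (fun n : ℕ => (n : ℝ) * sparseEdgeProb lam n) atTop (𝓝 lam) := by
  refine tendsto_const_nhds.congr' ?_
  filter_upwards [(tendsto_natCast_atTop_atTop (R := ℝ)).eventually_ge_atTop lam,
    eventually_gt_atTop 0] with n h1 hn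
  have hn0 : (0 : ℝ) < n := by exact_mod_cast hn
  rw [coe_sparseEdgeProb hlam h1]
  field_simp

/-- Tilting replaces `lam` by `lam * e ^ t` asymptotically. The normalisation of the tilted law
contributes `(lam / 2) (e ^ t - 1)` to the limit, the probability of `k n` triangle vertices
contributes `a t`. -/
theorem tendsto_log_mgf_edgeCount {lam : ℝ} (hlam : 0 < lam) {a : ℝ} (ha0 : 0 < a) (ha1 : a ≤ 1)
    {k : ℕ → ℕ} (hk : ∀ n : ℕ, |(k n : ℝ) - a * n| < 1) (t : ℝ) :
    Tendsto (fun n : ℕ => Real.log (mgf (fun G => (edgeCount G : ℝ))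
      (cond (sparseGraphLaw lam n)
        {G : SimpleGraph (Fin n) | triangleVertexCount G = k n}) t) / n) atTop
      (𝓝 (edgeCgf lam a t)) := by
  have hcast := tendsto_natCast_atTop_atTop (R := ℝ)
  set p : ℕ → unitInterval := sparseEdgeProb lam with hp
  have hpe : ∀ᶠ n : ℕ in atTop, (p n : ℝ) = lam / n := by
    filter_upwards [hcast.eventually_ge_atTop lam] with n hn
    exact coe_sparseEdgeProb hlam hn
  have hp1 : Tendsto (fun n : ℕ => (n : ℝ) * p n) atTop (𝓝 lam) := tendsto_mul_sparseEdgeProb hlam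
  set w := Real.exp t - 1 with hw
  have hwn : Tendsto (fun n : ℕ => w * lam / n) atTop (𝓝 0) :=
    tendsto_const_nhds.div_atTop hcast
  have hceq : ∀ᶠ n : ℕ in atTop, 1 - (p n : ℝ) + p n * Real.exp t = 1 + w * lam / n := by
    filter_upwards [hpe] with n h1
    rw [h1, hw]; ring
  have hclim : Tendsto (fun n : ℕ => 1 + w * lam / n) atTop (𝓝 1) := by
    simpa using hwn.const_add 1
  have hcpos : ∀ᶠ n : ℕ in atTop, 0 < 1 + w * lam / (n : ℝ) :=
    hclim.eventually_const_lt one_pos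
  have hp2 : Tendsto (fun n : ℕ => (n : ℝ) * tiltProb (p n) t) atTop
      (𝓝 (lam * Real.exp t)) := by
    have h := (hp1.mul_const (Real.exp t)).div hclim one_ne_zero
    rw [div_one] at h
    refine h.congr' ?_
    filter_upwards [hceq] with n h1
    change (n : ℝ) * p n * Real.exp t / (1 + w * lam / n) =
      n * (p n * Real.exp t / (1 - (p n : ℝ) + p n * Real.exp t))
    rw [h1]
    ring
  obtain ⟨hpos1, hlim1⟩ := tendsto_log_triangleVertexCount ha0 ha1 hk hlam hp1
  obtain ⟨hpos2, hlim2⟩ := tendsto_log_triangleVertexCount ha0 ha1 hk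
    (mul_pos hlam (Real.exp_pos t)) hp2
  have hlog : Tendsto (fun n : ℕ => (n : ℝ) * Real.log (1 + w * lam / n)) atTop
      (𝓝 (w * lam)) := (Real.tendsto_mul_log_one_add_div_atTop (w * lam)).comp hcast
  have hlog0 : Tendsto (fun n : ℕ => Real.log (1 + w * lam / (n : ℝ))) atTop (𝓝 0) := by
    simpa using hclim.log one_ne_zero
  have hsum := ((hlog.sub hlog0).mul_const (1 / 2)).add (hlim2.sub hlim1)
  have e : (w * lam - 0) * (1 / 2) + (a * Real.log (lam * Real.exp t) - a * Real.log lam) =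
      edgeCgf lam a t := by
    rw [Real.log_mul hlam.ne' (Real.exp_pos t).ne', Real.log_exp, edgeCgf, hw]
    ring
  rw [e] at hsum
  refine hsum.congr' ?_
  filter_upwards [hceq, hcpos, hpos1, hpos2, eventually_gt_atTop 0] with n h1 h2 h3 h4 hn
  have hn0 : (0 : ℝ) < n := by exact_mod_cast hn
  rw [sparseGraphLaw, mgf_edgeCount_cond _ t (by rw [← hp, h1]; exact h2), ← hp, h1,
    Real.log_div (by positivity) h3.ne', Real.log_mul (by positivity) h4.ne', Real.log_pow,
    Nat.card_eq_fintype_card, Fintype.card_fin, Nat.cast_choose_two]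
  field_simp
  ring

end SimpleGraph

theorem corollary2 (lam : ℝ) (hlam : 0 < lam) (a : ℝ) (ha0 : 0 < a) (ha1 : a ≤ 1)
    (k : ℕ → ℕ) (hk : ∀ n : ℕ, |(k n : ℝ) - a * n| < 1) :
    SatisfiesGoodLDP
      (fun n : ℕ => cond (sparseGraphLaw lam n)
        {G : SimpleGraph (Fin n) | triangleVertexCount G = k n})
      (fun (n : ℕ) (G : SimpleGraph (Fin n)) => (edgeCount G : ℝ) / (n : ℝ))
      (fun n : ℕ => (n : ℝ))
      (edgeRate lam a) := by
  refine satisfiesGoodLDP_of_tendsto_mgf hlam ?_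
    (SimpleGraph.tendsto_log_mgf_edgeCount hlam ha0 ha1 hk)
  filter_upwards [(SimpleGraph.tendsto_log_triangleVertexCount ha0 ha1 hk hlam
    (SimpleGraph.tendsto_mul_sparseEdgeProb hlam)).1] with n hn
  have : IsFiniteMeasure (sparseGraphLaw lam n) := by unfold sparseGraphLaw; infer_instance
  refine cond_isProbabilityMeasure fun h => ?_
  rw [measureReal_def, ← sparseGraphLaw, h] at hn
  simp at hn
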